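/- Let $d\ge 3$ and let $P$ be a $d$-polytope (a $d$-dimensional convex polytope). The degree $\deg v$ of a vertex $v$ of $P$ is the number of edges of $P$ containing $v$, the excess degree of $v$ is $\deg v-d$, and the excess degree of $P$ is the sum of the excess degrees of its vertices; a vertex is simple if its excess degree is $0$, and a polytope is simple if all its vertices are. A facet is a face of dimension $d-1$, and it is regarded as a $(d-1)$-polytope with its own degrees and excess. A facet $F$ of $P$ has Shephard's property if every vertex of $P$ in $F$ has exactly one neighbour (in the graph of $P$) outside $F$, and $P$ is a Shephard polytope if it has a facet with Shephard's property. $P$ is decomposable if it is the Minkowski sum of two polytopes, neither of which is homothetic to $P$ (homothetic meaning equal up to translation and scaling by a positive factor). $P$ is a pyramid if it is the convex hull of a polytope and a point outside the affine hull of that polytope. Suppose that the excess degree of $P$ is exactly $d-2$. Then $P$ has two distinct facets $F_1,F_2$, both of which are simple polytopes, such that at least one of the following holds: (i) $P$ has a unique nonsimple vertex $v$, and $F_1\cap F_2=\{v\}$; or (ii) $P$ has exactly $d-2$ nonsimple vertices, each of them has excess degree one, and they are the vertices of a $(d-3)$-dimensional simplex which is equal to $F_1\cap F_2$. Moreover $P$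 has a facet, different from $F_1$ and $F_2$, whose excess degree (as a $(d-1)$-polytope) is $d-3$; and $P$ is a Shephard polytope, and is decomposable or a pyramid. -/

import Mathlib

open scoped Pointwise

noncomputable section

namespace ConvexPolytope

variable {E : Type*} [NormedAddCommGroup E] [InnerProductSpace ℝ E]

/-- A (convex) polytope: the convex hull of a finite set of points. -/
def IsPolytope (P : Set E) : Prop :=
  ∃ S : Set E, S.Finite ∧ P = convexHull ℝ S

/-- The dimension of a nonempty convex set: the dimension of its affine hull. -/
def dim (P : Set E) : ℕ :=
  Module.finrank ℝ (vectorSpan ℝ P)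

/-- The faces of `P` are the empty set and the sets of maximizers over `P` of a linear functional
(the functional `0` gives `P` itself). -/
def IsFace (P F : Set E) : Prop :=
  IsExposed ℝ P F

/-- A facet of a `d`-polytope: a nonempty face of dimension `d - 1`. -/
def IsFacet (P F : Set E) : Prop :=
  IsFace P F ∧ F.Nonempty ∧ dim F + 1 = dim P

/-- The vertices of `P`. -/
def vertices (P : Set E) : Set E :=
  Set.extremePoints ℝ P

/-- The edges of `P`: its one-dimensional faces. -/
def edges (P : Set E) : Set (Set E) :=
  {e | IsFace P e ∧ dim e = 1}

/-- The degree of a vertex `v` of `P`: the number of edges of `P` incident with `v`. -/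
def degree (P : Set E) (v : E) : ℕ :=
  {e | e ∈ edges P ∧ v ∈ e}.ncard

/-- The excess degree of a vertex `v` of a `d`-polytope `P`: the integer `deg v - d`. -/
def vertexExcess (P : Set E) (v : E) : ℤ :=
  (degree P v : ℤ) - (dim P : ℤ)

/-- The excess degree of a polytope: the sum of the excess degrees of its (finitely many)
vertices. -/
def excess (P : Set E) : ℤ :=
  ∑ᶠ v ∈ vertices P, vertexExcess P v

/-- The vertices of a `d`-polytope whose degree is not `d`. -/
def nonsimpleVertices (P : Set E) : Set E :=
  {v | v ∈ vertices P ∧ degree P v ≠ dim P}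

/-- A polytope is simple if each of its vertices has degree equal to the dimension. A facet is
regarded here as a polytope of its own, with its own dimension, faces and degrees. -/
def IsSimple (P : Set E) : Prop :=
  ∀ v ∈ vertices P, degree P v = dim P

/-- Two points are adjacent (neighbours) in `P` if the segment joining them is an edge of `P`. -/
def Adjacent (P : Set E) (u v : E) : Prop :=
  u ≠ v ∧ segment ℝ u v ∈ edges P

/-- The facet `F` of `P` has Shephard's property: every vertex of `P` in `F` has a unique
neighbour outside `F`. -/
def HasShephardProperty (P F : Set E) : Prop :=
  ∀ v ∈ vertices P, v ∈ F → ∃! u, Adjacent P v u ∧ u ∉ F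

/-- A Shephard polytope has at least one facet with Shephard's property. -/
def IsShephard (P : Set E) : Prop :=
  ∃ F, IsFacet P F ∧ HasShephardProperty P F

/-- `P` is homothetic to `Q` if `Q = r P + t` with `r > 0`. -/
def Homothetic (P Q : Set E) : Prop :=
  ∃ (r : ℝ) (t : E), 0 < r ∧ Q = (fun x => r • x + t) '' P

/-- `P` is (Minkowski) decomposable: it is the Minkowski sum of two polytopes, neither of which
is homothetic to `P`. -/
def IsDecomposable (P : Set E) : Prop :=
  ∃ Q R : Set E, IsPolytope Q ∧ IsPolytope R ∧ P = Q + R ∧ ¬ Homothetic Q P ∧ ¬ Homothetic R P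

/-- `P` is a pyramid: the convex hull of a polytope `B` (the base) and a point (the apex) outside
the affine hull of `B`. -/
def IsPyramid (P : Set E) : Prop :=
  ∃ (B : Set E) (a : E), IsPolytope B ∧ a ∉ affineSpan ℝ B ∧ P = convexHull ℝ (insert a B)

/-- `K` is the simplex with vertex set `S`, of dimension `k`: the convex hull of the `k + 1`
affinely independent points of `S`. -/
def IsSimplexOn (K S : Set E) (k : ℕ) : Prop :=
  S.Finite ∧ S.ncard = k + 1 ∧ AffineIndependent ℝ ((↑) : S → E) ∧ K = convexHull ℝ S

end ConvexPolytope

end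

set_option linter.unusedSectionVars false

namespace ConvexPolytope

variable {E : Type*} [NormedAddCommGroup E] [InnerProductSpace ℝ E]

/-! ### Faces and vertices of polytopes -/

namespace IsPolytope

/-! Everything rests on counting edges at a vertex, by induction on `d`. For a facet `F` of `P`,
`excess P` equals `excess F` plus a sum of nonnegative defects: a vertex in `F` contributes its
number of neighbours off `F` minus one, a vertex off `F` its excess in `P` (`IsFacet.excess_eq`). If
all defects vanish, then `F` is simple, because a vertex whose only neighbour off `F` is simple is
itself simple. So a nonsimple facet has smaller excess than `P` (`IsFacet.excess_lt`).

If two simple facets meet in a face of dimension `j` with `0 ≤ j ≤ d - 3`, each of its at least `j +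
1` vertices has excess at least `d - 2 - j`, and `(j + 1)(d - 2 - j) = (d - 2) + j(d - 3 - j)`.
Hence the excess is at least `d - 2`, and equality forces `j = 0` or `j = d - 3`, a simplex as
intersection, and no further nonsimple vertices (`IsFacet.le_excess_of_inter`). Together with the
previous paragraph this bounds the excess of every nonsimple polytope below by `d - 2`.

It remains to find such a pair of facets when the excess is `d - 2`
(`IsPolytope.exists_simple_facets`). If all facets are simple, a nonsimple vertex supplies one.
Otherwise a nonsimple facet `F` has excess `d - 3` and a single vertex `w` of defect one; by
induction `F` has a pair of simple ridges of this kind, and the other facets over these ridges are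
simple, except possibly for `d = 4`, where another pair of 2-faces of `F` may be needed.

For `d ≥ 4` a local count excludes that all facets are simple, which yields the third facet. If `w`
is off the nonsimple facet, this facet has Shephard's property; if not, `w` is the only vertex of
`P` that may be nonsimple, and any facet missing `w` has the property. Finally, a Shephard facet can
be pushed parallel to itself along its outgoing edges. This decomposes `P` unless only one vertex
lies off the facet, in which case `P` is a pyramid. -/

theorem isCompact {P : Set E} (hP : IsPolytope P) : IsCompact P := by
  obtain ⟨S, hS, rfl⟩ := hP
  exact hS.isCompact_convexHull ℝ

theorem convex {P : Set E} (hP : IsPolytope P) : Convex ℝ P := by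
  obtain ⟨S, hS, rfl⟩ := hP
  exact convex_convexHull ℝ S

theorem finite_vertices {P : Set E} (hP : IsPolytope P) : (vertices P).Finite := by
  obtain ⟨S, hS, rfl⟩ := hP
  exact hS.subset extremePoints_convexHull_subset

end IsPolytope

theorem vertices_subset {P : Set E} : vertices P ⊆ P := extremePoints_subset

theorem eq_convexHull_vertices_of_finite {P : Set E} (hc : IsCompact P) (hconv : Convex ℝ P)
    (hfin : (vertices P).Finite) : P = convexHull ℝ (vertices P) := by
  have h := closure_convexHull_extremePoints hc hconv
  have hcl : IsClosed (convexHull ℝ (vertices P)) := hfin.isClosed_convexHull ℝ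
  rw [← hcl.closure_eq]
  exact h.symm

theorem IsPolytope.eq_convexHull_vertices {P : Set E} (hP : IsPolytope P) :
    P = convexHull ℝ (vertices P) :=
  eq_convexHull_vertices_of_finite hP.isCompact hP.convex hP.finite_vertices

theorem IsPolytope.vertices_nonempty {P : Set E} (hP : IsPolytope P) (hne : P.Nonempty) :
    (vertices P).Nonempty := by
  rw [hP.eq_convexHull_vertices] at hne
  exact convexHull_nonempty_iff.1 hne

theorem IsFace.subset {P F : Set E} (hF : IsFace P F) : F ⊆ P := IsExposed.subset hF

theorem IsFace.refl (P : Set E) : IsFace P P := IsExposed.refl P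

theorem IsFace.inter {P F G : Set E} (hF : IsFace P F) (hG : IsFace P G) : IsFace P (F ∩ G) :=
  IsExposed.inter hF hG

theorem IsFace.mono {P F G : Set E} (hG : IsFace P G) (hF : IsFace P F) (h : G ⊆ F) :
    IsFace F G := IsExposed.mono hG hF.subset h

theorem IsFace.vertices_eq {P F : Set E} (hF : IsFace P F) : vertices F = F ∩ vertices P :=
  (IsExposed.isExtreme hF).extremePoints_eq

theorem IsFace.isPolytope {P F : Set E} (hP : IsPolytope P) (hF : IsFace P F) : IsPolytope F := by
  have hfin : (vertices F).Finite := by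
    rw [hF.vertices_eq]
    exact hP.finite_vertices.inter_of_right _
  exact ⟨vertices F, hfin, eq_convexHull_vertices_of_finite (IsExposed.isCompact hF hP.isCompact)
    (IsExposed.convex hF hP.convex) hfin⟩

theorem IsFace.exists_functional {P F : Set E} (hF : IsFace P F) (hne : F.Nonempty) :
    ∃ (l : E →ₗ[ℝ] ℝ) (c : ℝ), (∀ x ∈ P, l x ≤ c) ∧ F = {x ∈ P | l x = c} := by
  obtain ⟨l, hl⟩ := hF hne
  obtain ⟨x₀, hx₀⟩ := hne
  have hx₀' := hx₀
  rw [hl] at hx₀'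
  refine ⟨l.toLinearMap, l x₀, fun x hx => hx₀'.2 x hx, ?_⟩
  ext x
  constructor
  · intro hx
    rw [hl] at hx
    exact ⟨hx.1, le_antisymm (hx₀'.2 x hx.1) (hx.2 x₀ hx₀'.1)⟩
  · rintro ⟨hx, hx'⟩
    rw [hl]
    refine ⟨hx, fun y hy => ?_⟩
    have : l x = l x₀ := hx'
    rw [this]
    exact hx₀'.2 y hy

theorem isFace_of_le [FiniteDimensional ℝ E] {P : Set E} (l : E →ₗ[ℝ] ℝ) (c : ℝ)
    (h : ∀ x ∈ P, l x ≤ c) : IsFace P {x ∈ P | l x = c} := by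
  rintro ⟨x₀, hx₀, hc⟩
  refine ⟨LinearMap.toContinuousLinearMap l, ?_⟩
  ext x
  simp only [Set.mem_ofPred_eq, LinearMap.coe_toContinuousLinearMap']
  constructor
  · rintro ⟨hx, hx'⟩
    exact ⟨hx, fun y hy => hx' ▸ h y hy⟩
  · rintro ⟨hx, hx'⟩
    exact ⟨hx, le_antisymm (h x hx) (hc ▸ hx' x₀ hx₀)⟩

theorem IsPolytope.le_of_vertices {P : Set E} (hP : IsPolytope P) (l : E →ₗ[ℝ] ℝ) (c : ℝ)
    (h : ∀ v ∈ vertices P, l v ≤ c) : ∀ x ∈ P, l x ≤ c := by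
  intro x hx
  rw [hP.eq_convexHull_vertices] at hx
  have hconv : Convex ℝ {y | l y ≤ c} := convex_halfSpace_le l.isLinear c
  exact convexHull_min h hconv hx

/-- An extreme point is not in the hull of the other vertices, which is closed, so a functional
separates it strictly from them and exposes it. -/
theorem IsPolytope.isFace_singleton {P : Set E} (hP : IsPolytope P) {v : E}
    (hv : v ∈ vertices P) : IsFace P {v} := by
  have h1 : v ∉ convexHull ℝ (vertices P \ {v}) := by
    have h2 := (hP.convex.mem_extremePoints_iff_mem_sdiff_convexHull_sdiff).1 hv
    exact fun h => h2.2 (convexHull_mono (Set.sdiff_subset_sdiff_left vertices_subset) h)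
  have hcl : IsClosed (convexHull ℝ (vertices P \ {v})) :=
    (hP.finite_vertices.subset Set.sdiff_subset).isClosed_convexHull ℝ
  obtain ⟨l, u, hu, hl⟩ := geometric_hahn_banach_point_closed (convex_convexHull ℝ _) hcl h1
  rintro -
  refine ⟨-l, ?_⟩
  have key : ∀ w ∈ vertices P, w ≠ v → l v < l w := fun w hw hwv =>
    hu.trans (hl w (subset_convexHull ℝ _ ⟨hw, hwv⟩))
  have hle : ∀ x ∈ P, (-l) x ≤ (-l) v := by
    refine hP.le_of_vertices (-l).toLinearMap _ ?_
    intro w hw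
    rcases eq_or_ne w v with rfl | h
    · exact le_rfl
    · exact neg_le_neg (key w hw h).le
  have hface : IsFace P {x ∈ P | ∀ y ∈ P, (-l) y ≤ (-l) x} := fun _ => ⟨-l, rfl⟩
  have hpoly := hface.isPolytope hP
  have hsub : vertices {x ∈ P | ∀ y ∈ P, (-l) y ≤ (-l) x} ⊆ {v} := by
    rw [hface.vertices_eq]
    rintro w ⟨⟨hw1, hw2⟩, hw3⟩
    by_contra hwv
    have h3 := hw2 v (vertices_subset hv)
    have h4 := key w hw3 hwv
    simp only [neg_apply, neg_le_neg_iff] at h3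
    linarith
  apply Set.Subset.antisymm
  · rintro x rfl
    exact ⟨vertices_subset hv, hle⟩
  · rw [hpoly.eq_convexHull_vertices]
    exact (convexHull_mono hsub).trans (by simp)

/-- A face of a face of a polytope is a face. -/
theorem IsFace.trans [FiniteDimensional ℝ E] {P F G : Set E} (hP : IsPolytope P)
    (hF : IsFace P F) (hG : IsFace F G) : IsFace P G := by
  rcases G.eq_empty_or_nonempty with rfl | hne
  · exact isExposed_empty
  obtain ⟨m, μ, hm, hGm⟩ := hG.exists_functional hne
  obtain ⟨l, c, hl, hFl⟩ := hF.exists_functional (hne.mono hG.subset)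
  -- The functional `N • l + m` exposes `G` once `N` is so large that the loss in `l` at the
  -- finitely many vertices off `F` outweighs any gain in `m`.
  have hev : ∀ᶠ N : ℝ in Filter.atTop, ∀ v ∈ vertices P, v ∉ F → N * l v + m v < N * c + μ := by
    rw [Filter.eventually_all_finite hP.finite_vertices]
    intro v hv
    by_cases hvF : v ∈ F
    · exact Filter.Eventually.of_forall fun N h => (h hvF).elim
    have hlt : l v < c := lt_of_le_of_ne (hl v (vertices_subset hv)) fun h =>
      hvF (by rw [hFl]; exact ⟨vertices_subset hv, h⟩)
    filter_upwards [Filter.eventually_gt_atTop ((m v - μ) / (c - l v))] with N hN _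
    rw [div_lt_iff₀ (by linarith)] at hN
    linarith
  obtain ⟨N, hN⟩ := hev.exists
  have hFc : ∀ x ∈ F, l x = c := fun x hx => by rw [hFl] at hx; exact hx.2
  have hv : ∀ v ∈ vertices P, (N • l + m) v ≤ N * c + μ := by
    intro v hv
    by_cases hvF : v ∈ F
    · simp only [LinearMap.add_apply, LinearMap.smul_apply, smul_eq_mul, hFc v hvF]
      linarith [hm v hvF]
    · exact (hN v hv hvF).le
  have hface := isFace_of_le _ _ (hP.le_of_vertices _ _ hv)
  have hGconv : Convex ℝ G := IsExposed.convex hG (IsExposed.convex hF hP.convex)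
  have : G = {x ∈ P | (N • l + m) x = N * c + μ} := by
    apply Set.Subset.antisymm
    · intro x hx
      have h1 := hx
      rw [hGm] at h1
      refine ⟨hF.subset h1.1, ?_⟩
      simp only [LinearMap.add_apply, LinearMap.smul_apply, smul_eq_mul, hFc x h1.1, h1.2]
    · rw [(hface.isPolytope hP).eq_convexHull_vertices]
      refine convexHull_min ?_ hGconv
      rw [hface.vertices_eq]
      rintro w ⟨⟨hw1, hw2⟩, hw3⟩
      by_cases hwF : w ∈ F
      · rw [hGm]
        simp only [LinearMap.add_apply, LinearMap.smul_apply, smul_eq_mul, hFc w hwF] at hw2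
        exact ⟨hwF, by linarith⟩
      · exact absurd hw2 (hN w hw3 hwF).ne
  rw [this]
  exact hface

theorem IsFace.functional_eq_zero {P F : Set E} {l : E →ₗ[ℝ] ℝ} {c : ℝ}
    (hF : F ⊆ {x ∈ P | l x = c}) : ∀ w ∈ vectorSpan ℝ F, l w = 0 := by
  intro w hw
  have : vectorSpan ℝ F ≤ LinearMap.ker l := by
    rw [vectorSpan_def, Submodule.span_le]
    rintro _ ⟨x, hx, y, hy, rfl⟩
    simp [(hF hx).2, (hF hy).2]
  exact this hw

theorem sub_mem_vectorSpan {P : Set E} {x y : E} (hx : x ∈ P) (hy : y ∈ P) :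
    x - y ∈ vectorSpan ℝ P := vsub_mem_vectorSpan ℝ hx hy

theorem IsFace.mem_of_sub_mem {P F : Set E} (hF : IsFace P F) {x y : E} (hy : y ∈ F)
    (hx : x ∈ P) (h : x - y ∈ vectorSpan ℝ F) : x ∈ F := by
  obtain ⟨l, c, hl, hFl⟩ := hF.exists_functional ⟨y, hy⟩
  have h1 := IsFace.functional_eq_zero hFl.subset _ h
  have h2 : l y = c := by rw [hFl] at hy; exact hy.2
  rw [map_sub, h2] at h1
  rw [hFl]
  exact ⟨hx, by linarith⟩

/-! ### Dimension of faces and separation by facets -/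

section FiniteDimensional

variable [FiniteDimensional ℝ E]

theorem dim_mono {F G : Set E} (h : F ⊆ G) : dim F ≤ dim G :=
  Submodule.finrank_mono (vectorSpan_mono ℝ h)

theorem IsFace.eq_of_dim_le {P F : Set E} (hF : IsFace P F) (hne : F.Nonempty)
    (h : dim P ≤ dim F) : F = P := by
  refine hF.subset.antisymm fun x hx => ?_
  obtain ⟨y, hy⟩ := hne
  have : vectorSpan ℝ F = vectorSpan ℝ P :=
    Submodule.eq_of_le_of_finrank_le (vectorSpan_mono ℝ hF.subset) h
  exact hF.mem_of_sub_mem hy hx (this ▸ sub_mem_vectorSpan hx (hF.subset hy))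

theorem IsFace.dim_lt {P F : Set E} (hF : IsFace P F) (hne : F.Nonempty)
    (h : F ≠ P) : dim F < dim P := by
  by_contra h'
  exact h (hF.eq_of_dim_le hne (not_lt.1 h'))

theorem dim_singleton (v : E) : dim ({v} : Set E) = 0 := by
  simp [dim]

theorem IsFace.dim_inter_lt {P F G : Set E} (hF : IsFace P F) (hG : IsFace P G)
    (hne : (F ∩ G).Nonempty) (h : ¬ F ⊆ G) : dim (F ∩ G) < dim F :=
  ((hF.inter hG).mono hF Set.inter_subset_left).dim_lt hne
    fun h' => h (Set.inter_eq_left.1 h')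

/-- Tilting a supporting functional `l` of the face `{l = c}` towards a functional `m` that is
constant on this face, until a new point of `P` is reached. -/
theorem IsPolytope.exists_rotation {P : Set E} (hP : IsPolytope P) {l m : E →ₗ[ℝ] ℝ} {c μ : ℝ}
    (hl : ∀ x ∈ P, l x ≤ c) (hm : ∀ x ∈ P, l x = c → m x = μ) {p : E} (hp : p ∈ P)
    (hpm : μ < m p) :
    ∃ s : ℝ, 0 < s ∧ (∀ x ∈ P, (l + s • m) x ≤ c + s * μ) ∧
      ∃ q ∈ P, μ < m q ∧ (l + s • m) q = c + s * μ := by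
  set W : Set E := {v ∈ vertices P | μ < m v} with hW
  have hWfin : W.Finite := hP.finite_vertices.subset (Set.sep_subset _ _)
  have hWne : W.Nonempty := by
    by_contra h
    rw [Set.not_nonempty_iff_eq_empty] at h
    have : ∀ v ∈ vertices P, m v ≤ μ := by
      intro v hv
      by_contra hlt
      have : v ∈ W := ⟨hv, not_le.1 hlt⟩
      rw [h] at this
      exact this
    exact absurd (hP.le_of_vertices m μ this p hp) (not_le.2 hpm)
  -- Ratio test: `q` is the first vertex reached by the tilted hyperplane, and its ratio is the
  -- tilting parameter `s`.
  obtain ⟨q, hq, hmin⟩ := Set.exists_min_image W (fun v => (c - l v) / (m v - μ)) hWfin hWne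
  have hqP : q ∈ P := vertices_subset hq.1
  have hqc : l q < c := lt_of_le_of_ne (hl q hqP) fun h => hq.2.ne' (hm q hqP h)
  have hqm : 0 < m q - μ := sub_pos.2 hq.2
  refine ⟨(c - l q) / (m q - μ), div_pos (by linarith) hqm, ?_, q, hqP, hq.2, ?_⟩
  · refine hP.le_of_vertices _ _ fun v hv => ?_
    simp only [LinearMap.add_apply, LinearMap.smul_apply, smul_eq_mul]
    have hs : 0 < (c - l q) / (m q - μ) := div_pos (by linarith) hqm
    by_cases hvm : μ < m v
    · have h1 := hmin v ⟨hv, hvm⟩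
      rw [le_div_iff₀ (sub_pos.2 hvm)] at h1
      linarith
    · have h1 := hl v (vertices_subset hv)
      have h2 := mul_le_mul_of_nonneg_left (not_lt.1 hvm) hs.le
      linarith
  · simp only [LinearMap.add_apply, LinearMap.smul_apply, smul_eq_mul]
    field_simp
    ring

theorem exists_functional_of_finrank_lt {W V : Submodule ℝ E}
    (h : Module.finrank ℝ W < Module.finrank ℝ V) :
    ∃ m : E →ₗ[ℝ] ℝ, (∀ w ∈ W, m w = 0) ∧ ∃ v ∈ V, m v ≠ 0 := by
  have : ¬ V ≤ W := fun h' => absurd (Submodule.finrank_mono h') (not_le.2 h)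
  obtain ⟨v, hv, hvW⟩ := SetLike.not_le_iff_exists.1 this
  obtain ⟨m, hm, hmW⟩ := Submodule.exists_le_ker_of_notMem hvW
  exact ⟨m, fun w hw => hmW hw, v, hv, hm⟩

theorem exists_ne_of_vectorSpan {P : Set E} {m : E →ₗ[ℝ] ℝ} {w : E} (hw : w ∈ vectorSpan ℝ P)
    (hmw : m w ≠ 0) (μ : ℝ) : ∃ q ∈ P, m q ≠ μ := by
  by_contra h
  push Not at h
  exact hmw (IsFace.functional_eq_zero (P := P) (fun x hx => ⟨hx, h x hx⟩) w hw)

theorem finrank_sup_span_singleton_le (W : Submodule ℝ E) (x : E) :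
    Module.finrank ℝ ↥(W ⊔ Submodule.span ℝ {x}) ≤ Module.finrank ℝ W + 1 := by
  refine (Submodule.finrank_add_le_finrank_add_finrank _ _).trans ?_
  gcongr
  exact (finrank_span_le_card ({x} : Set E)).trans (by simp)

/-- A face and a point outside it are separated by a facet containing the face. -/
theorem IsPolytope.exists_isFacet_notMem {P : Set E} (hP : IsPolytope P) {G : Set E}
    (hG : IsFace P G) (hne : G.Nonempty) {x : E} (hx : x ∈ P) (hxG : x ∉ G) :
    ∃ F, IsFacet P F ∧ G ⊆ F ∧ x ∉ F := by
  induction hn : dim P - dim G using Nat.strong_induction_on generalizing G with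
  | _ n ih =>
  subst hn
  have hlt : dim G < dim P := hG.dim_lt hne fun h => hxG (h ▸ hx)
  rcases Nat.lt_or_ge (dim G + 1) (dim P) with h1 | h1
  swap
  · exact ⟨G, ⟨hG, hne, by omega⟩, subset_rfl, hxG⟩
  obtain ⟨l, c, hl, hGl⟩ := hG.exists_functional hne
  obtain ⟨g, hg⟩ := hne
  have hgc : l g = c := by rw [hGl] at hg; exact hg.2
  -- Since `G` has codimension at least two, some `m` is constant on `G ∪ {x}` but not on `P`.
  -- Tilting towards `m` or `-m` enlarges `G` without reaching `x`.
  obtain ⟨m, hm, v, hv, hmv⟩ := exists_functional_of_finrank_lt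
    (lt_of_le_of_lt (finrank_sup_span_singleton_le (vectorSpan ℝ G) (x - g)) h1)
  have hmG : ∀ y ∈ P, l y = c → m y = m g := by
    intro y hy hyc
    have : m (y - g) = 0 := hm _ (Submodule.mem_sup_left (sub_mem_vectorSpan
      (by rw [hGl]; exact ⟨hy, hyc⟩) hg))
    rw [map_sub] at this
    linarith
  have hmx : m x = m g := by
    have : m (x - g) = 0 := hm _ (Submodule.mem_sup_right (Submodule.mem_span_singleton_self _))
    rw [map_sub] at this
    linarith
  have main : ∀ m : E →ₗ[ℝ] ℝ, (∀ y ∈ P, l y = c → m y = m g) → m x = m g →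
      (∃ p ∈ P, m g < m p) → ∃ F, IsFacet P F ∧ G ⊆ F ∧ x ∉ F := by
    intro m hmG hmx ⟨p, hp, hpm⟩
    obtain ⟨s, hs, hle, q, hq, hqm, hqe⟩ := hP.exists_rotation hl hmG hp hpm
    have hface := isFace_of_le _ _ hle
    have hsub : G ⊆ {x ∈ P | (l + s • m) x = c + s * m g} := by
      intro y hy
      rw [hGl] at hy
      refine ⟨hy.1, ?_⟩
      simp [hy.2, hmG y hy.1 hy.2]
    have hxn : x ∉ {x ∈ P | (l + s • m) x = c + s * m g} := by
      rintro ⟨-, h⟩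
      simp only [LinearMap.add_apply, LinearMap.smul_apply, smul_eq_mul, hmx] at h
      exact hxG (by rw [hGl]; exact ⟨hx, by linarith⟩)
    have hdim : dim G < dim {x ∈ P | (l + s • m) x = c + s * m g} := by
      refine (hG.mono hface hsub).dim_lt ⟨g, hg⟩ fun h => ?_
      have : q ∈ G := by rw [h]; exact ⟨hq, hqe⟩
      rw [hGl] at this
      exact hqm.ne' (hmG q hq this.2)
    obtain ⟨F, hF, hGF, hxF⟩ := ih _ (by omega) hface ⟨g, hsub hg⟩ hxn rfl
    exact ⟨F, hF, hsub.trans hGF, hxF⟩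
  obtain ⟨p, hp, hpm⟩ := exists_ne_of_vectorSpan hv hmv (m g)
  rcases lt_or_gt_of_ne hpm with h | h
  · refine main (-m) (fun y hy hyc => ?_) ?_ ⟨p, hp, ?_⟩
    · simp [hmG y hy hyc]
    · simp [hmx]
    · simpa using h
  · exact main m hmG hmx ⟨p, hp, h⟩

end FiniteDimensional

/-! ### Edges and neighbours -/

/-- The neighbours of `v` in the graph of `P`. -/
def nb (P : Set E) (v : E) : Set E := {u | Adjacent P v u}

theorem isPolytope_segment (u v : E) : IsPolytope (segment ℝ u v) :=
  ⟨{u, v}, by simp, (convexHull_pair u v).symm⟩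

theorem IsPolytope.exists_vertices_ne {P : Set E} (hP : IsPolytope P) (h : dim P ≠ 0) :
    ∃ u ∈ vertices P, ∃ v ∈ vertices P, u ≠ v := by
  by_contra hcon
  push Not at hcon
  apply h
  have hsub : (vertices P).Subsingleton := fun u hu v hv => hcon u hu v hv
  have : vectorSpan ℝ P = ⊥ := by
    rw [hP.eq_convexHull_vertices, ← direction_affineSpan, affineSpan_convexHull,
      direction_affineSpan]
    exact vectorSpan_of_subsingleton ℝ hsub
  rw [dim, this, finrank_bot]

theorem vertices_segment {u v : E} (h : dim (segment ℝ u v) = 1) :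
    vertices (segment ℝ u v) = {u, v} := by
  have hsub : vertices (segment ℝ u v) ⊆ {u, v} := by
    rw [← convexHull_pair]; exact extremePoints_convexHull_subset
  obtain ⟨a, ha, b, hb, hab⟩ := (isPolytope_segment u v).exists_vertices_ne (by omega)
  refine hsub.antisymm ?_
  rintro x (rfl | rfl) <;> rcases hsub ha with rfl | rfl <;> rcases hsub hb with rfl | rfl <;>
    first | assumption | exact absurd rfl hab

theorem Adjacent.isFace {P : Set E} {u v : E} (h : Adjacent P u v) :
    IsFace P (segment ℝ u v) := h.2.1

theorem Adjacent.symm {P : Set E} {u v : E} (h : Adjacent P u v) : Adjacent P v u :=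
  ⟨h.1.symm, segment_symm ℝ u v ▸ h.2⟩

theorem Adjacent.right_mem_vertices {P : Set E} {u v : E} (h : Adjacent P u v) :
    v ∈ vertices P := by
  have h1 : v ∈ vertices (segment ℝ u v) := by simp [vertices_segment h.2.2]
  rw [h.isFace.vertices_eq] at h1
  exact h1.2

theorem Adjacent.left_mem_vertices {P : Set E} {u v : E} (h : Adjacent P u v) :
    u ∈ vertices P := h.symm.right_mem_vertices

theorem nb_subset_vertices (P : Set E) (v : E) : nb P v ⊆ vertices P :=
  fun _ h => Adjacent.right_mem_vertices h

theorem nb_subset (P : Set E) (v : E) : nb P v ⊆ P :=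
  (nb_subset_vertices P v).trans vertices_subset

theorem IsPolytope.finite_nb {P : Set E} (hP : IsPolytope P) (v : E) : (nb P v).Finite :=
  hP.finite_vertices.subset (nb_subset_vertices P v)

section FiniteDimensional

variable [FiniteDimensional ℝ E]

theorem IsPolytope.eq_segment_of_dim_eq_one {e : Set E} (he : IsPolytope e) (h : dim e = 1)
    {v : E} (hv : v ∈ vertices e) : ∃ u, v ≠ u ∧ e = segment ℝ v u := by
  have hcol : Collinear ℝ e := by
    rw [collinear_iff_finrank_le_one]
    exact h.le
  obtain ⟨u, hu, huv⟩ : ∃ u ∈ vertices e, v ≠ u := by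
    obtain ⟨a, ha, b, hb, hab⟩ := he.exists_vertices_ne (by omega)
    by_cases hva : v = a
    · exact ⟨b, hb, hva ▸ hab⟩
    · exact ⟨a, ha, hva⟩
  refine ⟨u, huv, ?_⟩
  have hno : ∀ {a b c : E}, a ∈ vertices e → b ∈ vertices e → c ∈ vertices e →
      Wbtw ℝ a b c → b = a ∨ b = c := by
    intro a b c ha hb hc hw
    rw [← mem_segment_iff_wbtw] at hw
    by_contra hcon
    push Not at hcon
    have : b ∈ openSegment ℝ a c := mem_openSegment_of_ne_left_right hcon.1.symm hcon.2.symm hw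
    exact hcon.1 (hb.2 ha.1 hc.1 this).symm
  have : vertices e = {v, u} := by
    apply Set.Subset.antisymm
    · intro x hx
      have hsub : ({v, u, x} : Set E) ⊆ e := by
        rintro y (rfl | rfl | rfl)
        exacts [hv.1, hu.1, hx.1]
      rcases (hcol.subset hsub).wbtw_or_wbtw_or_wbtw with h1 | h1 | h1
      · rcases hno hv hu hx h1 with h2 | h2
        · exact absurd h2.symm huv
        · simp [h2]
      · rcases hno hu hx hv h1 with h2 | h2 <;> simp [h2]
      · rcases hno hx hv hu h1 with h2 | h2
        · simp [h2]
        · exact absurd h2 huv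
    · rintro y (rfl | rfl)
      exacts [hv, hu]
  rw [← convexHull_pair, ← this]
  exact he.eq_convexHull_vertices

theorem IsPolytope.degree_eq_ncard_nb {P : Set E} (hP : IsPolytope P) {v : E}
    (hv : v ∈ vertices P) : degree P v = (nb P v).ncard := by
  symm
  refine Set.ncard_congr (fun u _ => segment ℝ v u) ?_ ?_ ?_
  · exact fun u hu => ⟨hu.2, left_mem_segment ℝ v u⟩
  · intro a b ha hb hab
    have h1 := vertices_segment ha.2.2
    have hab' : segment ℝ v a = segment ℝ v b := hab
    rw [hab', vertices_segment hb.2.2] at h1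
    have : a ∈ ({v, b} : Set E) := by rw [h1]; simp
    rcases this with h | h
    · exact absurd h.symm ha.1
    · exact h
  · rintro e ⟨he, hve⟩
    have hve' : v ∈ vertices e := by rw [he.1.vertices_eq]; exact ⟨hve, hv⟩
    obtain ⟨u, huv, rfl⟩ := (he.1.isPolytope hP).eq_segment_of_dim_eq_one he.2 hve'
    exact ⟨u, ⟨huv, he⟩, rfl⟩

theorem IsFace.nb_eq {P G : Set E} (hP : IsPolytope P) (hG : IsFace P G) {v : E} (hv : v ∈ G) :
    nb G v = nb P v ∩ G := by
  ext u
  constructor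
  · intro h
    exact ⟨⟨h.1, hG.trans hP h.2.1, h.2.2⟩, nb_subset _ _ h⟩
  · rintro ⟨h, hu⟩
    refine ⟨h.1, h.isFace.mono hG ?_, h.2.2⟩
    exact (IsExposed.convex hG hP.convex).segment_subset hv hu

/-- Descend through facets containing `v` until the dimension is one. -/
theorem IsPolytope.exists_edge {P : Set E} (hP : IsPolytope P) (h : dim P ≠ 0) {v : E}
    (hv : v ∈ vertices P) : (nb P v).Nonempty := by
  induction hn : dim P using Nat.strong_induction_on generalizing P with
  | _ n ih =>
  subst hn
  obtain hd | hd : dim P = 1 ∨ 1 < dim P := by omega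
  · obtain ⟨u, huv, hPu⟩ := hP.eq_segment_of_dim_eq_one hd hv
    exact ⟨u, huv, hPu ▸ IsFace.refl P, hPu ▸ hd⟩
  · obtain ⟨x, hx, hxv⟩ : ∃ x ∈ P, x ≠ v := by
      obtain ⟨a, ha, b, hb, hab⟩ := hP.exists_vertices_ne h
      by_cases hva : a = v
      · exact ⟨b, hb.1, hva ▸ hab.symm⟩
      · exact ⟨a, ha.1, hva⟩
    obtain ⟨F, hF, hvF, hxF⟩ := hP.exists_isFacet_notMem (hP.isFace_singleton hv)
      (Set.singleton_nonempty v) hx hxv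
    have hvF' : v ∈ vertices F := by rw [hF.1.vertices_eq]; exact ⟨hvF rfl, hv⟩
    have hd' := hF.2.2
    obtain ⟨u, hu⟩ := ih (dim F) (by omega) (hF.1.isPolytope hP) (by omega) hvF' rfl
    rw [hF.1.nb_eq hP (hvF rfl)] at hu
    exact ⟨u, hu.1⟩

/-- A vertex at which a linear functional is at least as large as at all neighbours maximizes this
functional over the polytope. -/
theorem IsPolytope.le_of_nb {P : Set E} (hP : IsPolytope P) {v : E} (hv : v ∈ vertices P)
    (l : E →ₗ[ℝ] ℝ) (h : ∀ u ∈ nb P v, l u ≤ l v) : ∀ x ∈ P, l x ≤ l v := by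
  by_contra hcon
  push Not at hcon
  obtain ⟨x, hx, hlx⟩ := hcon
  obtain ⟨m, c, hm, hmv⟩ := (hP.isFace_singleton hv).exists_functional (Set.singleton_nonempty v)
  have hone : ∀ y ∈ P, m y = c → y = v := fun y hy hyc => by
    have : y ∈ ({v} : Set E) := by rw [hmv]; exact ⟨hy, hyc⟩
    exact this
  have hvc : m v = c := by
    have : v ∈ ({v} : Set E) := rfl
    rw [hmv] at this; exact this.2
  -- Tilt the functional `m` exposing `v` towards `l`. The new face contains `v` and a point with
  -- larger `l`, so it has an edge at `v`; along this edge `m` decreases, hence `l` increases,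
  -- against the hypothesis.
  obtain ⟨s, hs, hle, q, hq, hlq, hqe⟩ :=
    hP.exists_rotation hm (fun y hy hyc => by rw [hone y hy hyc]) hx hlx
  have hface := isFace_of_le _ _ hle
  have hvG : v ∈ {x ∈ P | (m + s • l) x = c + s * l v} := ⟨hv.1, by simp [hvc]⟩
  have hGp := hface.isPolytope hP
  have hdim : dim {x ∈ P | (m + s • l) x = c + s * l v} ≠ 0 := by
    intro h0
    have := ((hP.isFace_singleton hv).mono hface (by simpa using hvG)).eq_of_dim_le
      (Set.singleton_nonempty v) (by rw [h0]; exact Nat.zero_le _)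
    have hq' : q ∈ ({v} : Set E) := by rw [this]; exact ⟨hq, hqe⟩
    rw [Set.mem_singleton_iff.1 hq'] at hlq
    exact lt_irrefl _ hlq
  have hvG' : v ∈ vertices {x ∈ P | (m + s • l) x = c + s * l v} := by
    rw [hface.vertices_eq]; exact ⟨hvG, hv⟩
  obtain ⟨u, hu⟩ := hGp.exists_edge hdim hvG'
  rw [hface.nb_eq hP hvG] at hu
  have h1 := h u hu.1
  have h2 : (m + s • l) u = c + s * l v := hu.2.2
  simp only [LinearMap.add_apply, LinearMap.smul_apply, smul_eq_mul] at h2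
  have h3 : m u ≤ c := hm u hu.2.1
  have h4 : m u ≠ c := fun h4 => hu.1.1 (hone u hu.2.1 h4).symm
  have h5 := mul_le_mul_of_nonneg_left h1 hs.le
  have : m u < c := lt_of_le_of_ne h3 h4
  linarith

/-- A functional that is constant on `v` and its neighbours is both maximal and minimal at `v`, so
it is constant on `P`. -/
theorem IsPolytope.sub_mem_span_nb {P : Set E} (hP : IsPolytope P) {v : E} (hv : v ∈ vertices P)
    {x : E} (hx : x ∈ P) : x - v ∈ Submodule.span ℝ ((fun u => u - v) '' nb P v) := by
  by_contra h
  obtain ⟨l, hl, hker⟩ := Submodule.exists_le_ker_of_notMem h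
  have h0 : ∀ u ∈ nb P v, l u = l v := by
    intro u hu
    have : l (u - v) = 0 := hker (Submodule.subset_span ⟨u, hu, rfl⟩)
    rw [map_sub] at this
    linarith
  have h1 := hP.le_of_nb hv l (fun u hu => (h0 u hu).le) x hx
  have h2 := hP.le_of_nb hv (-l) (fun u hu => by simp [h0 u hu]) x hx
  simp only [LinearMap.neg_apply] at h2
  apply hl
  rw [map_sub]
  linarith

theorem IsPolytope.vectorSpan_eq {P : Set E} (hP : IsPolytope P) {v : E} (hv : v ∈ vertices P) :
    vectorSpan ℝ P = Submodule.span ℝ ((fun u => u - v) '' nb P v) := by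
  apply le_antisymm
  · rw [vectorSpan_def, Submodule.span_le]
    rintro _ ⟨x, hx, y, hy, rfl⟩
    have := Submodule.sub_mem _ (hP.sub_mem_span_nb hv hx) (hP.sub_mem_span_nb hv hy)
    simpa using this
  · rw [Submodule.span_le]
    rintro _ ⟨u, hu, rfl⟩
    exact sub_mem_vectorSpan (nb_subset _ _ hu) hv.1

theorem IsPolytope.dim_le_degree {P : Set E} (hP : IsPolytope P) {v : E} (hv : v ∈ vertices P) :
    dim P ≤ degree P v := by
  rw [hP.degree_eq_ncard_nb hv, dim, hP.vectorSpan_eq hv]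
  have hfin := (hP.finite_nb v).image (fun u => u - v)
  have := hfin.fintype
  refine (finrank_span_le_card _).trans ?_
  rw [← Set.ncard_eq_toFinset_card']
  exact Set.ncard_image_le (hP.finite_nb v)

theorem IsPolytope.linearIndepOn_nb {P : Set E} (hP : IsPolytope P) {v : E}
    (hv : v ∈ vertices P) (h : degree P v = dim P) :
    LinearIndepOn ℝ (fun u => u - v) (nb P v) := by
  have := (hP.finite_nb v).fintype
  rw [LinearIndepOn, linearIndependent_iff_card_eq_finrank_span]
  have h1 : Set.range (fun u : nb P v => (u : E) - v) = (fun u => u - v) '' nb P v := by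
    ext; simp
  rw [h1, Set.finrank, ← hP.vectorSpan_eq hv, ← dim, ← h, hP.degree_eq_ncard_nb hv,
    Set.ncard_eq_toFinset_card', Set.toFinset_card]

theorem IsFace.mem_vertices_of_mem {P G : Set E} (hG : IsFace P G) {v : E} (hv : v ∈ vertices P)
    (hvG : v ∈ G) : v ∈ vertices G := by
  rw [hG.vertices_eq]; exact ⟨hvG, hv⟩

/-- A simple vertex of a polytope is simple in every face containing it. -/
theorem IsFace.degree_eq_dim {P G : Set E} (hP : IsPolytope P) (hG : IsFace P G) {v : E}
    (hv : v ∈ vertices P) (hvG : v ∈ G) (h : degree P v = dim P) : degree G v = dim G := by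
  have hGp := hG.isPolytope hP
  have hvG' := hG.mem_vertices_of_mem hv hvG
  have hli : LinearIndepOn ℝ (fun u => u - v) (nb G v) :=
    (hP.linearIndepOn_nb hv h).mono (by rw [hG.nb_eq hP hvG]; exact Set.inter_subset_left)
  have := (hGp.finite_nb v).fintype
  rw [LinearIndepOn, linearIndependent_iff_card_eq_finrank_span] at hli
  have h1 : Set.range (fun u : nb G v => (u : E) - v) = (fun u => u - v) '' nb G v := by
    ext; simp
  rw [h1, Set.finrank, ← hGp.vectorSpan_eq hvG', ← dim] at hli
  rw [hGp.degree_eq_ncard_nb hvG', ← hli, Set.ncard_eq_toFinset_card', Set.toFinset_card]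

/-- The edges of `F` at `v` span the direction of `F`, so a face is determined by its neighbours of
one vertex. -/
theorem IsFace.subset_of_nb_subset {P F G : Set E} (hP : IsPolytope P) (hF : IsFace P F)
    (hG : IsFace P G) {v : E} (hv : v ∈ vertices P) (hvF : v ∈ F) (hvG : v ∈ G)
    (h : nb F v ⊆ G) : F ⊆ G := by
  intro x hx
  refine hG.mem_of_sub_mem hvG (hF.subset hx) ?_
  have h1 := (hF.isPolytope hP).sub_mem_span_nb (hF.mem_vertices_of_mem hv hvF) hx
  refine Submodule.span_le.2 ?_ h1
  rintro _ ⟨u, hu, rfl⟩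
  exact sub_mem_vectorSpan (h hu) hvG

theorem IsFace.exists_nb_notMem {P F G : Set E} (hP : IsPolytope P) (hF : IsFace P F)
    (hG : IsFace P G) {v : E} (hv : v ∈ vertices P) (hvF : v ∈ F) (hvG : v ∈ G)
    (h : ¬ F ⊆ G) : ∃ u ∈ nb F v, u ∉ G := by
  by_contra hcon
  push Not at hcon
  exact h (hF.subset_of_nb_subset hP hG hv hvF hvG hcon)

theorem IsFace.inter_nb {P F G : Set E} (hP : IsPolytope P) (hF : IsFace P F)
    (hG : IsFace P G) {v : E} (hvF : v ∈ F) (hvG : v ∈ G) :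
    nb (F ∩ G) v = nb F v ∩ nb G v := by
  rw [(hF.inter hG).nb_eq hP ⟨hvF, hvG⟩, hF.nb_eq hP hvF, hG.nb_eq hP hvG]
  ext; simp only [Set.mem_inter_iff]; tauto

end FiniteDimensional

/-! ### Ridges and the facets containing a face -/

theorem IsFacet.isPolytope {P F : Set E} (hP : IsPolytope P) (hF : IsFacet P F) : IsPolytope F :=
  hF.1.isPolytope hP

section FiniteDimensional

variable [FiniteDimensional ℝ E]

theorem IsFacet.eq_of_subset {P F G : Set E} (hF : IsFacet P F) (hG : IsFacet P G) (h : F ⊆ G) :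
    F = G := by
  refine (hF.1.mono hG.1 h).eq_of_dim_le hF.2.1 ?_
  have h1 := hF.2.2
  have h2 := hG.2.2
  omega

theorem IsFacet.not_subset {P F G : Set E} (hF : IsFacet P F) (hG : IsFacet P G) (h : F ≠ G) :
    ¬ F ⊆ G := fun h' => h (hF.eq_of_subset hG h')

theorem IsFacet.dim_inter {P F G : Set E} (hF : IsFacet P F) (hG : IsFacet P G) (h : F ≠ G)
    (hne : (F ∩ G).Nonempty) : dim (F ∩ G) + 2 ≤ dim P := by
  have h1 := hF.1.dim_inter_lt hG.1 hne (hF.not_subset hG h)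
  have h2 := hF.2.2
  omega

theorem IsFacet.inter_eq_of_ridge {P F G R : Set E} (hF : IsFacet P F) (hG : IsFacet P G)
    (h : F ≠ G) (hR : IsFacet F R) (hRG : R ⊆ G) : F ∩ G = R := by
  have hsub : R ⊆ F ∩ G := Set.subset_inter hR.1.subset hRG
  have h1 := hF.dim_inter hG h (hR.2.1.mono hsub)
  refine ((hR.1.mono ((hF.1.inter hG.1).mono hF.1 Set.inter_subset_left) hsub).eq_of_dim_le
    hR.2.1 ?_).symm
  have h2 := hF.2.2
  have h3 := hR.2.2
  omega

/-- A facet of `P` that contains the ridge `R` and avoids a point of `F \ R` is the second facet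
over `R`. -/
theorem IsFacet.exists_other {P F R : Set E} (hP : IsPolytope P) (hF : IsFacet P F)
    (hR : IsFacet F R) : ∃ G, IsFacet P G ∧ G ≠ F ∧ F ∩ G = R := by
  obtain ⟨x, hx, hxR⟩ : ∃ x ∈ F, x ∉ R := by
    by_contra h
    push Not at h
    have := dim_mono h
    have := hR.2.2
    omega
  obtain ⟨G, hG, hRG, hxG⟩ := hP.exists_isFacet_notMem (hF.1.trans hP hR.1) hR.2.1
    (hF.1.subset hx) hxR
  have hne : F ≠ G := fun h => hxG (h ▸ hx)
  exact ⟨G, hG, hne.symm, hF.inter_eq_of_ridge hG hne hR hRG⟩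

/-- A vector off the direction of a facet `F` spans, together with `F`, the direction of `P`. -/
theorem IsFacet.exists_sub_smul_mem {P F : Set E} (hF : IsFacet P F) {r x w : E} (hr : r ∈ F)
    (hx : x ∈ P) (hxF : x ∉ F) (hw : w ∈ vectorSpan ℝ P) :
    ∃ a : ℝ, w - a • (x - r) ∈ vectorSpan ℝ F := by
  have hrP := hF.1.subset hr
  have hle : vectorSpan ℝ F ⊔ Submodule.span ℝ {x - r} ≤ vectorSpan ℝ P := by
    refine sup_le (vectorSpan_mono ℝ hF.1.subset) ?_
    rw [Submodule.span_singleton_le_iff_mem]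
    exact sub_mem_vectorSpan hx hrP
  have hlt : vectorSpan ℝ F < vectorSpan ℝ F ⊔ Submodule.span ℝ {x - r} := by
    refine lt_of_le_of_ne le_sup_left fun h => hxF (hF.1.mem_of_sub_mem hr hx ?_)
    rw [h]
    exact Submodule.mem_sup_right (Submodule.mem_span_singleton_self _)
  have heq : vectorSpan ℝ F ⊔ Submodule.span ℝ {x - r} = vectorSpan ℝ P := by
    refine Submodule.eq_of_le_of_finrank_le hle ?_
    have h1 := Submodule.finrank_lt_finrank_of_lt hlt
    have h2 := hF.2.2
    unfold dim at h2
    omega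
  rw [← heq, Submodule.mem_sup] at hw
  obtain ⟨u, hu, z, hz, rfl⟩ := hw
  obtain ⟨a, rfl⟩ := Submodule.mem_span_singleton.1 hz
  exact ⟨a, by rwa [add_sub_cancel_right]⟩

theorem IsFace.exists_functional_sub {P F : Set E} (hF : IsFace P F) {r : E} (hr : r ∈ F) :
    ∃ l : E →ₗ[ℝ] ℝ, (∀ w ∈ vectorSpan ℝ F, l w = 0) ∧ ∀ x ∈ P, x ∉ F → l (x - r) < 0 := by
  obtain ⟨l, c, hl, hFl⟩ := hF.exists_functional ⟨r, hr⟩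
  refine ⟨l, IsFace.functional_eq_zero hFl.subset, fun x hx hxF => ?_⟩
  have h1 : l r = c := by rw [hFl] at hr; exact hr.2
  have h2 : l x < c := lt_of_le_of_ne (hl x hx) fun h => hxF (by rw [hFl]; exact ⟨hx, h⟩)
  rw [map_sub]
  linarith

/-- No three facets contain a common ridge. -/
theorem IsFacet.ridge_unique {P F G H R : Set E} (hF : IsFacet P F) (hG : IsFacet P G)
    (hH : IsFacet P H) (hR : IsFacet F R) (hRG : R ⊆ G) (hRH : R ⊆ H) (hFG : F ≠ G)
    (hFH : F ≠ H) : G = H := by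
  by_contra hGH
  obtain ⟨r, hr⟩ := hR.2.1
  have hrF := hR.1.subset hr
  have hrG := hRG hr
  have hrH := hRH hr
  have eFG := hF.inter_eq_of_ridge hG hFG hR hRG
  have eFH := hF.inter_eq_of_ridge hH hFH hR hRH
  have hRG' : IsFacet G R := by
    refine ⟨?_, hR.2.1, ?_⟩
    · rw [← eFG]
      exact (hF.1.inter hG.1).mono hG.1 Set.inter_subset_right
    · have h1 := hF.2.2
      have h2 := hG.2.2
      have h3 := hR.2.2
      omega
  have eGH := hG.inter_eq_of_ridge hH hGH hRG' hRH
  have hex : ∀ {A : Set E}, dim R + 1 = dim A → ∃ x ∈ A, x ∉ R := by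
    intro A hA
    by_contra h
    push Not at h
    have := dim_mono h
    omega
  obtain ⟨x, hx, hxR⟩ := hex hR.2.2
  obtain ⟨y, hy, hyR⟩ := hex hRG'.2.2
  obtain ⟨z, hz, hzR⟩ := hex (A := H) (by
    have h1 := hF.2.2
    have h2 := hH.2.2
    have h3 := hR.2.2
    omega)
  have hxG : x ∉ G := fun h => hxR (eFG ▸ ⟨hx, h⟩)
  have hxH : x ∉ H := fun h => hxR (eFH ▸ ⟨hx, h⟩)
  have hyF : y ∉ F := fun h => hyR (eFG ▸ ⟨h, hy⟩)
  have hyH : y ∉ H := fun h => hyR (eGH ▸ ⟨hy, h⟩)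
  have hzF : z ∉ F := fun h => hzR (eFH ▸ ⟨h, hz⟩)
  have hzG : z ∉ G := fun h => hzR (eGH ▸ ⟨h, hz⟩)
  have hxP := hF.1.subset hx
  have hyP := hG.1.subset hy
  have hzP := hH.1.subset hz
  obtain ⟨f, hf0, hf⟩ := hF.1.exists_functional_sub hrF
  obtain ⟨g, hg0, hg⟩ := hG.1.exists_functional_sub hrG
  obtain ⟨h, hh0, hh⟩ := hH.1.exists_functional_sub hrH
  -- Modulo the direction of `R`, `z - r = b • (y - r) + a • (x - r)`. Applying `f` gives `b > 0`,
  -- applying `g` gives `a > 0`, and then `h` is negative on the right but zero on the left.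
  obtain ⟨b, hb⟩ := hF.exists_sub_smul_mem hrF hyP hyF
    (sub_mem_vectorSpan hzP (hF.1.subset hrF))
  obtain ⟨a, ha⟩ := hR.exists_sub_smul_mem hr hx hxR hb
  have e1 := hf0 _ hb
  have e2 := hg0 _ (vectorSpan_mono ℝ hRG ha)
  have e3 := hh0 _ (vectorSpan_mono ℝ hRH ha)
  have e4 := hg0 _ (sub_mem_vectorSpan hy hrG)
  have e5 := hh0 _ (sub_mem_vectorSpan hz hrH)
  simp only [map_sub, map_smul, smul_eq_mul] at e1 e2 e3 e4 e5
  have i1 := hf y hyP hyF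
  have i2 := hf z hzP hzF
  have i3 := hg x hxP hxG
  have i4 := hg z hzP hzG
  have i5 := hh x hxP hxH
  have i6 := hh y hyP hyH
  simp only [map_sub] at i1 i2 i3 i4 i5 i6
  have hb0 : 0 < b := by
    by_contra hcon
    have := mul_nonneg_of_nonpos_of_nonpos (not_lt.1 hcon) i1.le
    linarith
  have ha0 : 0 < a := by
    by_contra hcon
    have := mul_nonneg_of_nonpos_of_nonpos (not_lt.1 hcon) i3.le
    rw [e4] at e2
    linarith
  have := mul_neg_of_pos_of_neg hb0 i6
  have := mul_neg_of_pos_of_neg ha0 i5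
  linarith

/-- In a polygon the edges are the facets and `{v}` is a ridge, so three edges at `v` would
contradict `IsFacet.ridge_unique`. In lower dimension an edge is the whole polytope. -/
theorem IsPolytope.degree_le_two {P : Set E} (hP : IsPolytope P) (h : dim P ≤ 2) {v : E}
    (hv : v ∈ vertices P) : degree P v ≤ 2 := by
  have hdv := dim_singleton v
  by_contra hcon
  obtain ⟨a, ha, b, hb, c, hc, hab, hac, hbc⟩ := (Set.two_lt_ncard_iff (by
    refine Set.finite_of_ncard_ne_zero fun h0 => hcon ?_
    have h1 : degree P v = 0 := h0
    omega)).1 (not_le.1 hcon) |> fun ⟨a, b, c, ha, hb, hc, h1, h2, h3⟩ =>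
      (⟨a, ha, b, hb, c, hc, h1, h2, h3⟩ : ∃ a ∈ {e | e ∈ edges P ∧ v ∈ e},
        ∃ b ∈ {e | e ∈ edges P ∧ v ∈ e}, ∃ c ∈ {e | e ∈ edges P ∧ v ∈ e}, a ≠ b ∧ a ≠ c ∧ b ≠ c)
  have h2 : dim P = 2 := by
    by_contra hne
    have hfull : ∀ e ∈ edges P, v ∈ e → e = P := fun e he hve =>
      he.1.eq_of_dim_le ⟨v, hve⟩ (by have := he.2; omega)
    exact hab ((hfull a ha.1 ha.2).trans (hfull b hb.1 hb.2).symm)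
  have hfac : ∀ e ∈ {e | e ∈ edges P ∧ v ∈ e}, IsFacet P e := fun e he =>
    ⟨he.1.1, ⟨v, he.2⟩, by rw [he.1.2, h2]⟩
  have hva : IsFacet a {v} :=
    ⟨(hP.isFace_singleton hv).mono ha.1.1 (by simpa using ha.2), Set.singleton_nonempty v, by
      rw [hdv, ha.1.2]⟩
  exact hbc ((hfac a ha).ridge_unique (hfac b hb) (hfac c hc) hva (by simpa using hb.2)
    (by simpa using hc.2) hab hac)

theorem IsPolytope.isSimple_of_dim_le_two {P : Set E} (hP : IsPolytope P) (h : dim P ≤ 2) :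
    IsSimple P := by
  intro v hv
  have h1 := hP.dim_le_degree hv
  have h2 := hP.degree_le_two h hv
  by_contra hne
  have hlt : dim P ≤ 1 := by omega
  have hfull : ∀ e ∈ edges P, v ∈ e → e = P := fun e he hve =>
    he.1.eq_of_dim_le ⟨v, hve⟩ (by have := he.2; omega)
  have hd : degree P v ≤ 1 := by
    have : {e | e ∈ edges P ∧ v ∈ e} ⊆ {P} := fun e he => hfull e he.1 he.2
    exact (Set.ncard_le_ncard this).trans (by simp)
  have h0 : dim P = 0 := by omega
  obtain ⟨e, he⟩ := Set.nonempty_of_ncard_ne_zero (show degree P v ≠ 0 by omega)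
  have := hfull e he.1 he.2
  have h3 := he.1.2
  rw [this] at h3
  omega

/-- The facets of `P` containing the set `G`. -/
def facetsThrough (P G : Set E) : Set (Set E) := {F | IsFacet P F ∧ G ⊆ F}

theorem IsPolytope.finite_faces {P : Set E} (hP : IsPolytope P) : {F | IsFace P F}.Finite := by
  refine Set.Finite.of_finite_image (f := vertices) ?_ ?_
  · refine hP.finite_vertices.finite_subsets.subset ?_
    rintro _ ⟨F, hF, rfl⟩
    have : vertices F ⊆ vertices P := by
      rw [IsFace.vertices_eq hF]; exact Set.inter_subset_right
    exact this
  · intro F hF G hG h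
    have hF' := IsFace.isPolytope hP hF
    have hG' := IsFace.isPolytope hP hG
    have h' : vertices F = vertices G := h
    rw [hF'.eq_convexHull_vertices, h', ← hG'.eq_convexHull_vertices]

theorem IsPolytope.finite_facetsThrough {P : Set E} (hP : IsPolytope P) (G : Set E) :
    (facetsThrough P G).Finite := hP.finite_faces.subset fun _ h => h.1.1

/-- A `k`-face of a `d`-polytope is contained in at least `d - k` facets. -/
theorem IsPolytope.le_ncard_facetsThrough {P G : Set E} (hP : IsPolytope P) (hG : IsFace P G)
    (hne : G.Nonempty) : dim P ≤ dim G + (facetsThrough P G).ncard := by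
  induction hn : dim P generalizing P with
  | zero => omega
  | succ n ih =>
  by_cases hGP : G = P
  · rw [hGP, hn]; omega
  obtain ⟨x, hx, hxG⟩ : ∃ x ∈ P, x ∉ G := by
    by_contra h
    push Not at h
    exact hGP (hG.subset.antisymm h)
  obtain ⟨F, hF, hGF, -⟩ := hP.exists_isFacet_notMem hG hne hx hxG
  have hFp := hF.isPolytope hP
  have hFn : dim F = n := by have := hF.2.2; omega
  have hih := ih hFp (hG.mono hF.1 hGF) hFn
  -- Each facet of `F` through `G` is a ridge of `P` and yields a second facet of `P`; these are
  -- distinct, and `F` itself is one more.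
  have hex : ∀ R ∈ facetsThrough F G, ∃ H, IsFacet P H ∧ H ≠ F ∧ F ∩ H = R := fun R hR =>
    hF.exists_other hP hR.1
  choose! f hf using hex
  have hinj : Set.InjOn f (facetsThrough F G) := by
    intro R hR S hS h
    rw [← (hf R hR).2.2, ← (hf S hS).2.2, h]
  have hsub : insert F (f '' facetsThrough F G) ⊆ facetsThrough P G := by
    rintro H (rfl | ⟨R, hR, rfl⟩)
    · exact ⟨hF, hGF⟩
    · refine ⟨(hf R hR).1, hR.2.trans ?_⟩
      have := (hf R hR).2.2
      exact fun y hy => (this.symm ▸ hy : y ∈ F ∩ f R).2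
  have hnot : F ∉ f '' facetsThrough F G := by
    rintro ⟨R, hR, h⟩
    exact (hf R hR).2.1 h
  have h1 := Set.ncard_le_ncard hsub (hP.finite_facetsThrough G)
  rw [Set.ncard_insert_of_notMem hnot ((hFp.finite_facetsThrough G).image f),
    hinj.ncard_image] at h1
  omega

/-- A vertex of a `d`-polytope contained in at most `d` facets is simple. -/
theorem IsPolytope.degree_eq_dim_of_facets {P : Set E} (hP : IsPolytope P) {v : E}
    (hv : v ∈ vertices P) (h : (facetsThrough P {v}).ncard ≤ dim P) : degree P v = dim P := by
  refine le_antisymm ?_ (hP.dim_le_degree hv)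
  rw [hP.degree_eq_ncard_nb hv]
  have hfin := hP.finite_facetsThrough {v}
  -- The edge from `v` to `u` lies in at least `d - 1` of the at most `d` facets through `v`, so
  -- exactly one of them misses `u`.
  have hmiss : ∀ u ∈ nb P v, ∃ F ∈ facetsThrough P {v}, u ∉ F ∧
      ∀ G ∈ facetsThrough P {v}, u ∉ G → G = F := by
    intro u hu
    obtain ⟨F, hF, hvF, huF⟩ := hP.exists_isFacet_notMem (hP.isFace_singleton hv)
      (Set.singleton_nonempty v) (nb_subset _ _ hu) (Ne.symm hu.1)
    refine ⟨F, ⟨hF, hvF⟩, huF, fun G hG huG => ?_⟩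
    by_contra hne
    have h1 := hP.le_ncard_facetsThrough hu.isFace ⟨v, left_mem_segment ℝ v u⟩
    have h2 : facetsThrough P (segment ℝ v u) ⊆ (facetsThrough P {v} \ {F}) \ {G} := by
      rintro H ⟨hH, hsub⟩
      refine ⟨⟨⟨hH, by simpa using hsub (left_mem_segment ℝ v u)⟩, ?_⟩, ?_⟩
      · rintro rfl
        exact huF (hsub (right_mem_segment ℝ v u))
      · rintro rfl
        exact huG (hsub (right_mem_segment ℝ v u))
    have h3 := Set.ncard_le_ncard h2 (hfin.sdiff.sdiff)
    have h4 : F ∈ facetsThrough P {v} := ⟨hF, hvF⟩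
    have h5 : G ∈ facetsThrough P {v} \ {F} := ⟨hG, hne⟩
    have h6 := Set.ncard_sdiff_singleton_add_one h4 hfin
    have h7 := Set.ncard_sdiff_singleton_add_one h5 hfin.sdiff
    have h8 := hu.2.2
    omega
  choose! f hf using hmiss
  refine (Set.ncard_le_ncard_of_injOn f (fun u hu => (hf u hu).1) ?_ hfin).trans h
  -- Distinct neighbours are missed by distinct facets: some facet contains the edge to `u` and
  -- misses `w`.
  intro u hu w hw huw
  by_contra hne
  have hwn : w ∉ segment ℝ v u := by
    intro hmem
    have h1 : w ∈ vertices (segment ℝ v u) :=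
      hu.isFace.mem_vertices_of_mem (nb_subset_vertices _ _ hw) hmem
    rw [vertices_segment hu.2.2] at h1
    rcases h1 with h1 | h1
    · exact hw.1 h1.symm
    · exact hne h1.symm
  obtain ⟨F, hF, hsub, hwF⟩ := hP.exists_isFacet_notMem hu.isFace
    ⟨v, left_mem_segment ℝ v u⟩ (nb_subset _ _ hw) hwn
  have hvF : F ∈ facetsThrough P {v} := ⟨hF, by simpa using hsub (left_mem_segment ℝ v u)⟩
  have h1 := (hf w hw).2.2 F hvF hwF
  apply (hf u hu).2.1
  rw [huw, ← h1]
  exact hsub (right_mem_segment ℝ v u)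

/-- A simple vertex of a `d`-polytope is contained in at most `d` facets. -/
theorem IsPolytope.ncard_facetsThrough_le {P : Set E} (hP : IsPolytope P) (hd : 0 < dim P) {v : E}
    (hv : v ∈ vertices P) (h : degree P v = dim P) :
    (facetsThrough P {v}).ncard ≤ dim P := by
  obtain ⟨T, hT⟩ := (hP.finite_nb v).exists_finset_coe
  have hTc : T.card = dim P := by
    rw [← h, hP.degree_eq_ncard_nb hv, ← hT, Set.ncard_coe_finset]
  -- A facet through `v` is determined by its `d - 1` neighbours of `v`, chosen among `d`.
  have hmaps : ∀ F ∈ facetsThrough P {v}, nb F v ∈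
      (fun s : Finset E => (s : Set E)) '' (T.powersetCard (dim P - 1) : Set (Finset E)) := by
    rintro F ⟨hF, hvF⟩
    have hvF' : v ∈ F := by simpa using hvF
    have hFp := hF.isPolytope hP
    obtain ⟨S, hS⟩ := (hFp.finite_nb v).exists_finset_coe
    refine ⟨S, ?_, hS⟩
    rw [Finset.mem_coe, Finset.mem_powersetCard]
    refine ⟨?_, ?_⟩
    · rw [← Finset.coe_subset, hS, hT, hF.1.nb_eq hP hvF']
      exact Set.inter_subset_left
    · rw [← Set.ncard_coe_finset, hS, ← hFp.degree_eq_ncard_nb (hF.1.mem_vertices_of_mem hv hvF'),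
        hF.1.degree_eq_dim hP hv hvF' h]
      have := hF.2.2
      omega
  refine (Set.ncard_le_ncard_of_injOn (fun F => nb F v) hmaps ?_
    ((Finset.finite_toSet _).image _)).trans ?_
  · rintro F ⟨hF, hvF⟩ G ⟨hG, hvG⟩ hFG
    have hFG' : nb F v = nb G v := hFG
    exact hF.eq_of_subset hG (hF.1.subset_of_nb_subset hP hG.1 hv (by simpa using hvF)
      (by simpa using hvG) (hFG' ▸ nb_subset G v))
  · refine (Set.ncard_image_le (Finset.finite_toSet _)).trans ?_
    rw [Set.ncard_coe_finset, Finset.card_powersetCard, hTc]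
    obtain ⟨n, hn⟩ : ∃ n, dim P = n + 1 := ⟨dim P - 1, by omega⟩
    rw [hn, Nat.add_sub_cancel, Nat.choose_succ_self_right]

end FiniteDimensional

/-! ### The excess degree -/

theorem IsPolytope.excess_eq_sum {P : Set E} (hP : IsPolytope P) :
    excess P = ∑ v ∈ hP.finite_vertices.toFinset, vertexExcess P v :=
  finsum_mem_eq_finite_toFinset_sum _ _

theorem vertexExcess_eq_zero_iff {P : Set E} {v : E} :
    vertexExcess P v = 0 ↔ degree P v = dim P := by
  unfold vertexExcess; omega

theorem IsSimple.excess_eq_zero {P : Set E} (hP : IsPolytope P) (h : IsSimple P) :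
    excess P = 0 := by
  rw [hP.excess_eq_sum]
  refine Finset.sum_eq_zero fun v hv => ?_
  rw [vertexExcess_eq_zero_iff]
  exact h v (by simpa using hv)

section FiniteDimensional

variable [FiniteDimensional ℝ E]

theorem IsPolytope.vertexExcess_nonneg {P : Set E} (hP : IsPolytope P) {v : E}
    (hv : v ∈ vertices P) : 0 ≤ vertexExcess P v := by
  have := hP.dim_le_degree hv
  unfold vertexExcess; omega

theorem IsFace.degree_eq_add {P F : Set E} (hP : IsPolytope P) (hF : IsFace P F) {v : E}
    (hv : v ∈ vertices P) (hvF : v ∈ F) :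
    degree P v = degree F v + (nb P v \ F).ncard := by
  rw [hP.degree_eq_ncard_nb hv, (hF.isPolytope hP).degree_eq_ncard_nb
    (hF.mem_vertices_of_mem hv hvF), hF.nb_eq hP hvF,
    Set.ncard_inter_add_ncard_sdiff_eq_ncard _ _ (hP.finite_nb v)]

theorem IsFacet.ne {P F : Set E} (hF : IsFacet P F) : F ≠ P := by
  rintro rfl
  have := hF.2.2
  omega

theorem IsFacet.one_le_out {P F : Set E} (hP : IsPolytope P) (hF : IsFacet P F) {v : E}
    (hv : v ∈ vertices P) (hvF : v ∈ F) : 1 ≤ (nb P v \ F).ncard := by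
  obtain ⟨u, hu, huF⟩ := (IsFace.refl P).exists_nb_notMem hP hF.1 hv hv.1 hvF
    fun h => hF.ne (hF.1.subset.antisymm h)
  rw [Nat.one_le_iff_ne_zero]
  exact Set.ncard_ne_zero_of_mem (a := u) ⟨hu, huF⟩ (hP.finite_nb v).sdiff

theorem IsFacet.out_eq_one {P F : Set E} (hP : IsPolytope P) (hF : IsFacet P F) {v : E}
    (hv : v ∈ vertices P) (hvF : v ∈ F) (h : degree P v = dim P) : (nb P v \ F).ncard = 1 := by
  have h1 := hF.1.degree_eq_add hP hv hvF
  have h2 := hF.1.degree_eq_dim hP hv hvF h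
  have h3 := hF.2.2
  omega

/-- If the only neighbour of `v` off a facet through `v` is simple, then so is `v`. -/
theorem IsFacet.degree_eq_dim_of_out {P F : Set E} (hP : IsPolytope P) (hF : IsFacet P F) {v u : E}
    (hv : v ∈ vertices P) (hvF : v ∈ F) (hout : nb P v \ F = {u}) (hu : degree P u = dim P) :
    degree P v = dim P := by
  apply hP.degree_eq_dim_of_facets hv
  have hu' : u ∈ nb P v \ F := by rw [hout]; rfl
  have huV := nb_subset_vertices _ _ hu'.1
  have hd : 0 < dim P := by have := hF.2.2; omega
  obtain ⟨H, hH, huH, hvH⟩ := hP.exists_isFacet_notMem (hP.isFace_singleton huV)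
    (Set.singleton_nonempty u) hv.1 hu'.1.1
  -- A facet through `v` other than `F` has an edge at `v` leaving `F`, so it contains `u`. Of the
  -- at most `d` facets through `u`, the facet `H` misses `v`, which makes room for `F`.
  have hsub : facetsThrough P {v} ⊆ insert F (facetsThrough P {u} \ {H}) := by
    rintro G ⟨hG, hvG⟩
    have hvG' : v ∈ G := by simpa using hvG
    by_cases hGF : G = F
    · exact Or.inl hGF
    · right
      obtain ⟨w, hw, hwF⟩ := hG.1.exists_nb_notMem hP hF.1 hv hvG' hvF (hG.not_subset hF hGF)
      have hwu : w ∈ nb P v \ F := ⟨by rw [hG.1.nb_eq hP hvG'] at hw; exact hw.1, hwF⟩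
      rw [hout, Set.mem_singleton_iff] at hwu
      refine ⟨⟨hG, ?_⟩, ?_⟩
      · rw [Set.singleton_subset_iff, ← hwu]
        exact nb_subset _ _ hw
      · rintro rfl
        exact hvH hvG'
  have hfin := hP.finite_facetsThrough {u}
  have h1 := Set.ncard_le_ncard hsub (hfin.sdiff.insert F)
  have h2 := Set.ncard_insert_le F (facetsThrough P {u} \ {H})
  have h3 := Set.ncard_sdiff_singleton_add_one (show H ∈ facetsThrough P {u} from ⟨hH, huH⟩) hfin
  have h4 := hP.ncard_facetsThrough_le hd huV hu
  omega

/-- A vertex is simple if it is simple in a facet that meets all other facets through this vertex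
in ridges. -/
theorem IsFacet.degree_eq_dim_of_inter {P F : Set E} (hP : IsPolytope P) (hd : 2 ≤ dim P)
    (hF : IsFacet P F) {v : E} (hv : v ∈ vertices P) (hvF : v ∈ F) (hs : degree F v = dim F)
    (h : ∀ G, IsFacet P G → v ∈ G → G ≠ F → dim P ≤ dim (F ∩ G) + 2) : degree P v = dim P := by
  apply hP.degree_eq_dim_of_facets hv
  have hFp := hF.isPolytope hP
  have hdF := hF.2.2
  have hfin := hP.finite_facetsThrough {v}
  -- Intersecting with `F` injects the other facets through `v` into the facets of `F` through `v`,
  -- of which there are at most `d - 1`.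
  have hmap : ∀ G ∈ facetsThrough P {v} \ {F}, F ∩ G ∈ facetsThrough F {v} := by
    rintro G ⟨⟨hG, hvG⟩, hGF⟩
    have hvG' : v ∈ G := by simpa using hvG
    refine ⟨⟨(hF.1.inter hG.1).mono hF.1 Set.inter_subset_left, ⟨v, hvF, hvG'⟩, ?_⟩, ?_⟩
    · have h1 := h G hG hvG' hGF
      have h2 := hF.dim_inter hG (Ne.symm hGF) ⟨v, hvF, hvG'⟩
      omega
    · simpa using ⟨hvF, hvG'⟩
  have hinj : Set.InjOn (fun G => F ∩ G) (facetsThrough P {v} \ {F}) := by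
    rintro G hG H hH hGH
    have hGH' : F ∩ G = F ∩ H := hGH
    exact hF.ridge_unique hG.1.1 hH.1.1 (hmap G hG).1 Set.inter_subset_right
      (hGH' ▸ Set.inter_subset_right) (Ne.symm hG.2) (Ne.symm hH.2)
  have h1 := Set.ncard_le_ncard_of_injOn _ hmap hinj (hFp.finite_facetsThrough {v})
  have h2 := hFp.ncard_facetsThrough_le (by omega) (hF.1.mem_vertices_of_mem hv hvF) hs
  have h3 := Set.ncard_sdiff_singleton_add_one
    (show F ∈ facetsThrough P {v} from ⟨hF, by simpa using hvF⟩) hfin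
  omega

/-- The difference between the contributions of a vertex to the excess of `P` and to that of the
facet `F`. -/
noncomputable def excessDefect (P F : Set E) (v : E) : ℤ :=
  open Classical in
  if v ∈ F then ((nb P v \ F).ncard : ℤ) - 1 else vertexExcess P v

theorem IsFacet.excessDefect_nonneg {P F : Set E} (hP : IsPolytope P) (hF : IsFacet P F) {v : E}
    (hv : v ∈ vertices P) : 0 ≤ excessDefect P F v := by
  unfold excessDefect
  split_ifs with hvF
  · have := hF.one_le_out hP hv hvF
    omega
  · exact hP.vertexExcess_nonneg hv

theorem IsFacet.vertexExcess_eq {P F : Set E} (hP : IsPolytope P) (hF : IsFacet P F) {v : E}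
    (hv : v ∈ vertices P) (hvF : v ∈ F) :
    vertexExcess P v = vertexExcess F v + excessDefect P F v := by
  have h1 := hF.1.degree_eq_add hP hv hvF
  have h2 := hF.2.2
  rw [excessDefect, if_pos hvF]
  unfold vertexExcess
  omega

theorem IsFacet.excess_eq {P F : Set E} (hP : IsPolytope P) (hF : IsFacet P F) :
    excess P = excess F + ∑ v ∈ hP.finite_vertices.toFinset, excessDefect P F v := by
  classical
  rw [hP.excess_eq_sum, (hF.isPolytope hP).excess_eq_sum]
  have : (hF.isPolytope hP).finite_vertices.toFinset =
      hP.finite_vertices.toFinset.filter (· ∈ F) := by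
    ext v
    simp [hF.1.vertices_eq, and_comm]
  rw [this, Finset.sum_filter, ← Finset.sum_add_distrib]
  refine Finset.sum_congr rfl fun v hv => ?_
  split_ifs with hvF
  · exact hF.vertexExcess_eq hP (by simpa using hv) hvF
  · rw [zero_add, excessDefect, if_neg hvF]

/-- If the vertices off a facet `F` are simple and `v` has one neighbour off `F`, then `v` is
simple. -/
theorem IsFacet.degree_eq_dim_of_excessDefect {P F : Set E} (hP : IsPolytope P) (hF : IsFacet P F)
    {v : E} (hv : v ∈ vertices P) (h0 : excessDefect P F v = 0)
    (h : ∀ u ∈ nb P v, u ∉ F → excessDefect P F u = 0) : degree P v = dim P := by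
  by_cases hvF : v ∈ F
  · rw [excessDefect, if_pos hvF] at h0
    obtain ⟨u, hu⟩ := Set.ncard_eq_one.1 (show (nb P v \ F).ncard = 1 by omega)
    have hu' : u ∈ nb P v \ F := by rw [hu]; rfl
    have h1 := h u hu'.1 hu'.2
    rw [excessDefect, if_neg hu'.2, vertexExcess_eq_zero_iff] at h1
    exact hF.degree_eq_dim_of_out hP hv hvF hu h1
  · rwa [excessDefect, if_neg hvF, vertexExcess_eq_zero_iff] at h0

/-- The excess of a nonsimple facet is smaller than that of the polytope. -/
theorem IsFacet.excess_lt {P F : Set E} (hP : IsPolytope P) (hF : IsFacet P F)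
    (hns : ¬ IsSimple F) : excess F + 1 ≤ excess P := by
  have h1 := hF.excess_eq hP
  have hnn : ∀ v ∈ hP.finite_vertices.toFinset, 0 ≤ excessDefect P F v := fun v hv =>
    hF.excessDefect_nonneg hP (by simpa using hv)
  have h2 := Finset.sum_nonneg hnn
  -- Otherwise all defects vanish, which makes every vertex of `F` simple in `P` and hence in `F`.
  by_contra hcon
  have h3 : ∑ v ∈ hP.finite_vertices.toFinset, excessDefect P F v = 0 := by omega
  rw [Finset.sum_eq_zero_iff_of_nonneg hnn] at h3
  apply hns
  intro v hv
  rw [hF.1.vertices_eq] at hv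
  refine hF.1.degree_eq_dim hP hv.2 hv.1 (hF.degree_eq_dim_of_excessDefect hP hv.2
    (h3 v (by simpa using hv.2)) fun u hu _ => h3 u ?_)
  simpa using nb_subset_vertices _ _ hu

theorem IsPolytope.dim_lt_ncard_vertices {P : Set E} (hP : IsPolytope P) (hne : P.Nonempty) :
    dim P + 1 ≤ (vertices P).ncard := by
  have := hP.finite_vertices.fintype
  have := (hP.vertices_nonempty hne).to_subtype
  have h : vectorSpan ℝ P = vectorSpan ℝ (Set.range ((↑) : vertices P → E)) := by
    conv_lhs => rw [hP.eq_convexHull_vertices]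
    rw [← direction_affineSpan, affineSpan_convexHull, direction_affineSpan, Subtype.range_coe]
  rw [dim, h, Set.ncard_eq_toFinset_card', Set.toFinset_card]
  exact finrank_vectorSpan_range_add_one_le ℝ _

theorem IsPolytope.affineIndependent_vertices {P : Set E} (hP : IsPolytope P) {k : ℕ}
    (hk : dim P = k) (h : (vertices P).ncard = k + 1) :
    AffineIndependent ℝ ((↑) : vertices P → E) := by
  have := hP.finite_vertices.fintype
  have h' : vectorSpan ℝ P = vectorSpan ℝ (Set.range ((↑) : vertices P → E)) := by
    conv_lhs => rw [hP.eq_convexHull_vertices]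
    rw [← direction_affineSpan, affineSpan_convexHull, direction_affineSpan, Subtype.range_coe]
  rw [affineIndependent_iff_finrank_vectorSpan_eq ℝ _ (n := k), ← h', ← dim, hk]
  rw [← h, Set.ncard_eq_toFinset_card', Set.toFinset_card]

/-- Every common vertex of two simple facets `F` and `G` has excess at least
`d - 2 - dim (F ∩ G)`. -/
theorem IsFacet.le_vertexExcess_of_inter {P F G : Set E} (hP : IsPolytope P) (hF : IsFacet P F)
    (hG : IsFacet P G) (hFs : IsSimple F) (hGs : IsSimple G) {v : E} (hv : v ∈ vertices P)
    (hvF : v ∈ F) (hvG : v ∈ G) :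
    (nb F v ∪ nb G v).ncard + dim (F ∩ G) + 2 = 2 * dim P ∧
    (dim P : ℤ) - 2 - dim (F ∩ G) ≤ vertexExcess P v := by
  have hFp := hF.isPolytope hP
  have hGp := hG.isPolytope hP
  have hvF' := hF.1.mem_vertices_of_mem hv hvF
  have hvG' := hG.1.mem_vertices_of_mem hv hvG
  have hI : IsFace F (F ∩ G) := (hF.1.inter hG.1).mono hF.1 Set.inter_subset_left
  have h1 := hFs v hvF'
  have h2 := hGs v hvG'
  have h3 := hI.degree_eq_dim hFp hvF' ⟨hvF, hvG⟩ h1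
  rw [hFp.degree_eq_ncard_nb hvF'] at h1
  rw [hGp.degree_eq_ncard_nb hvG'] at h2
  rw [(hI.isPolytope hFp).degree_eq_ncard_nb (hI.mem_vertices_of_mem hvF' ⟨hvF, hvG⟩),
    hF.1.inter_nb hP hG.1 hvF hvG] at h3
  -- Inclusion-exclusion: `F` and `G` contain `d - 1` neighbours of `v` each, of which `dim (F ∩ G)`
  -- are common.
  have h4 := Set.ncard_union_add_ncard_inter (nb F v) (nb G v) (hFp.finite_nb v) (hGp.finite_nb v)
  have h5 : nb F v ∪ nb G v ⊆ nb P v := by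
    rw [hF.1.nb_eq hP hvF, hG.1.nb_eq hP hvG]
    exact Set.union_subset Set.inter_subset_left Set.inter_subset_left
  have h6 := Set.ncard_le_ncard h5 (hP.finite_nb v)
  rw [← hP.degree_eq_ncard_nb hv] at h6
  have h7 := hF.2.2
  have h8 := hG.2.2
  unfold vertexExcess
  constructor <;> omega

/-- The excess is split into nonnegative surpluses over the bound `(j + 1)(d - 2 - j)`, where `j =
dim (F ∩ G)`. If the excess is `d - 2`, each surplus vanishes separately, and this is the whole
structure in the theorem. -/
theorem IsFacet.le_excess_of_inter {P F G : Set E} (hP : IsPolytope P) (hF : IsFacet P F)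
    (hG : IsFacet P G) (hFs : IsSimple F) (hGs : IsSimple G) (hne : (F ∩ G).Nonempty)
    (hdim : dim (F ∩ G) + 3 ≤ dim P) : (dim P : ℤ) - 2 ≤ excess P ∧
    (excess P = (dim P : ℤ) - 2 → (dim (F ∩ G) = 0 ∨ dim (F ∩ G) + 3 = dim P) ∧
      nonsimpleVertices P = vertices (F ∩ G) ∧
      (vertices (F ∩ G)).ncard = dim (F ∩ G) + 1 ∧
      ∀ v ∈ vertices (F ∩ G), vertexExcess P v = (dim P : ℤ) - 2 - dim (F ∩ G)) := by
  classical
  have hI : IsFace P (F ∩ G) := hF.1.inter hG.1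
  have hIp := hI.isPolytope hP
  have hcard := hIp.dim_lt_ncard_vertices hne
  set j := dim (F ∩ G) with hj
  set V := hP.finite_vertices.toFinset with hV
  set W := hIp.finite_vertices.toFinset with hW
  have hWc : (vertices (F ∩ G)).ncard = W.card := by
    rw [Set.ncard_eq_toFinset_card _ hIp.finite_vertices]
  have hWV : W ⊆ V := by
    intro v
    simp only [hW, hV, Set.Finite.mem_toFinset, hI.vertices_eq]
    exact fun h => h.2
  have hle : ∀ v ∈ W, (dim P : ℤ) - 2 - j ≤ vertexExcess P v := by
    intro v hv
    rw [hW, Set.Finite.mem_toFinset, hI.vertices_eq] at hv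
    exact (hF.le_vertexExcess_of_inter hP hG hFs hGs hv.2 hv.1.1 hv.1.2).2
  have hnn : ∀ v ∈ V, 0 ≤ vertexExcess P v := fun v hv =>
    hP.vertexExcess_nonneg (by simpa [hV] using hv)
  have h1 : ∑ v ∈ V, vertexExcess P v =
      ∑ v ∈ W, (vertexExcess P v - ((dim P : ℤ) - 2 - j)) + ∑ v ∈ V \ W, vertexExcess P v
        + W.card * ((dim P : ℤ) - 2 - j) := by
    rw [← Finset.sum_sdiff hWV, Finset.sum_sub_distrib, Finset.sum_const, nsmul_eq_mul]
    ring
  have hA : ∀ v ∈ W, 0 ≤ vertexExcess P v - ((dim P : ℤ) - 2 - j) := fun v hv => by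
    linarith [hle v hv]
  have hB : ∀ v ∈ V \ W, 0 ≤ vertexExcess P v := fun v hv => hnn v (Finset.sdiff_subset hv)
  have h2 := Finset.sum_nonneg hA
  have h3 := Finset.sum_nonneg hB
  rw [hWc] at hcard ⊢
  have h4 : (0 : ℤ) ≤ j * ((dim P : ℤ) - 3 - j) := mul_nonneg (by positivity) (by omega)
  have h5 : (0 : ℤ) ≤ ((W.card : ℤ) - (j + 1)) * ((dim P : ℤ) - 2 - j) :=
    mul_nonneg (by omega) (by omega)
  have h6 : (W.card : ℤ) * ((dim P : ℤ) - 2 - j) = ((dim P : ℤ) - 2) + j * ((dim P : ℤ) - 3 - j)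
      + ((W.card : ℤ) - (j + 1)) * ((dim P : ℤ) - 2 - j) := by ring
  rw [hP.excess_eq_sum, ← hV, h1, h6]
  refine ⟨by linarith, fun heq => ?_⟩
  have e1 : (j : ℤ) * ((dim P : ℤ) - 3 - j) = 0 := by linarith
  have e2 : ((W.card : ℤ) - (j + 1)) * ((dim P : ℤ) - 2 - j) = 0 := by linarith
  have e3 : ∑ v ∈ W, (vertexExcess P v - ((dim P : ℤ) - 2 - j)) = 0 := by linarith
  have e4 : ∑ v ∈ V \ W, vertexExcess P v = 0 := by linarith
  rw [Finset.sum_eq_zero_iff_of_nonneg hA] at e3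
  rw [Finset.sum_eq_zero_iff_of_nonneg hB] at e4
  refine ⟨?_, ?_, ?_, ?_⟩
  · rcases mul_eq_zero.1 e1 with h | h
    · left; omega
    · right; omega
  · ext v
    constructor
    · rintro ⟨hv, hvd⟩
      by_contra hvW
      apply hvd
      rw [← vertexExcess_eq_zero_iff]
      exact e4 v (by simpa [hV, hW] using ⟨hv, hvW⟩)
    · intro hv
      have h7 := e3 v (by simpa [hW] using hv)
      have hv' := hv
      rw [hI.vertices_eq] at hv'
      refine ⟨hv'.2, fun h => ?_⟩
      rw [vertexExcess_eq_zero_iff.2 h] at h7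
      omega
  · rcases mul_eq_zero.1 e2 with h | h <;> omega
  · intro v hv
    have h7 := e3 v (by simpa [hW] using hv)
    linarith

theorem IsPolytope.exists_isFacet_mem {P : Set E} (hP : IsPolytope P) (hd : dim P ≠ 0) {v : E}
    (hv : v ∈ vertices P) : ∃ F, IsFacet P F ∧ v ∈ F := by
  obtain ⟨u, hu⟩ := hP.exists_edge hd hv
  obtain ⟨F, hF, hvF, -⟩ := hP.exists_isFacet_notMem (hP.isFace_singleton hv)
    (Set.singleton_nonempty v) (nb_subset _ _ hu) (Ne.symm hu.1)
  exact ⟨F, hF, by simpa using hvF⟩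

/-- Through a nonsimple vertex of a polytope with simple facets there are two facets that do not
meet in a ridge. -/
theorem IsPolytope.exists_facets_of_not_simple {P : Set E} (hP : IsPolytope P) (hd : 2 ≤ dim P)
    (hs : ∀ F, IsFacet P F → IsSimple F) {v : E} (hv : v ∈ vertices P) (hvd : degree P v ≠ dim P) :
    ∃ F G, IsFacet P F ∧ IsFacet P G ∧ F ≠ G ∧ v ∈ F ∧ v ∈ G ∧ dim (F ∩ G) + 3 ≤ dim P := by
  obtain ⟨F, hF, hvF⟩ := hP.exists_isFacet_mem (by omega) hv
  by_contra hcon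
  push Not at hcon
  refine hvd (hF.degree_eq_dim_of_inter hP hd hv hvF
    (hs F hF v (hF.1.mem_vertices_of_mem hv hvF)) fun G hG hvG hGF => ?_)
  have := hcon F G hF hG (Ne.symm hGF) hvF hvG
  omega

/-- The excess degree of a nonsimple `d`-polytope is at least `d - 2`. -/
theorem IsPolytope.le_excess {P : Set E} (hP : IsPolytope P) (hns : ¬ IsSimple P) :
    (dim P : ℤ) - 2 ≤ excess P := by
  induction hn : dim P generalizing P with
  | zero => exact absurd (hP.isSimple_of_dim_le_two (by omega)) hns
  | succ n ih =>
  have hd : 2 < dim P := by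
    by_contra h
    exact hns (hP.isSimple_of_dim_le_two (not_lt.1 h))
  by_cases hs : ∀ F, IsFacet P F → IsSimple F
  · unfold IsSimple at hns
    push Not at hns
    obtain ⟨v, hv, hvd⟩ := hns
    obtain ⟨F, G, hF, hG, -, hvF, hvG, hFG⟩ := hP.exists_facets_of_not_simple hd.le hs hv hvd
    have := (hF.le_excess_of_inter hP hG (hs F hF) (hs G hG) ⟨v, hvF, hvG⟩ hFG).1
    rwa [hn] at this
  · push Not at hs
    obtain ⟨F, hF, hFs⟩ := hs
    have h1 := ih (hF.isPolytope hP) hFs (by have := hF.2.2; omega)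
    have h2 := hF.excess_lt hP hFs
    push_cast
    linarith

end FiniteDimensional

/-! ### Polytopes of excess `d - 2` -/

section FiniteDimensional

variable [FiniteDimensional ℝ E]

/-- Squeezed between `IsFacet.excess_lt` and the lower bound in dimension `d - 1`. -/
theorem IsFacet.excess_eq_of_not_isSimple {P F : Set E} (hP : IsPolytope P) (hF : IsFacet P F)
    (hns : ¬ IsSimple F) (hex : excess P = (dim P : ℤ) - 2) : excess F = (dim P : ℤ) - 3 := by
  have h1 := hF.excess_lt hP hns
  have h2 := (hF.isPolytope hP).le_excess hns
  have h3 := hF.2.2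
  omega

/-- If the excess of a facet is one less than that of the polytope, a single vertex is responsible
for the difference. -/
theorem IsFacet.exists_excessDefect {P F : Set E} (hP : IsPolytope P) (hF : IsFacet P F)
    (h : excess P = excess F + 1) : ∃ w ∈ vertices P, excessDefect P F w = 1 ∧
      ∀ v ∈ vertices P, v ≠ w → excessDefect P F v = 0 := by
  classical
  have h1 := hF.excess_eq hP
  have hnn : ∀ v ∈ hP.finite_vertices.toFinset, 0 ≤ excessDefect P F v := fun v hv =>
    hF.excessDefect_nonneg hP (by simpa using hv)
  have hsum : ∑ v ∈ hP.finite_vertices.toFinset, excessDefect P F v = 1 := by omega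
  obtain ⟨w, hw, hw0⟩ := Finset.exists_ne_zero_of_sum_ne_zero (by rw [hsum]; exact one_ne_zero)
  rw [← Finset.add_sum_erase _ _ hw] at hsum
  have hnn' : ∀ v ∈ hP.finite_vertices.toFinset.erase w, 0 ≤ excessDefect P F v := fun v hv =>
    hnn v (Finset.mem_of_mem_erase hv)
  have h2 := Finset.sum_nonneg hnn'
  have h3 := hnn w hw
  have h4 : ∑ v ∈ hP.finite_vertices.toFinset.erase w, excessDefect P F v = 0 := by omega
  rw [Finset.sum_eq_zero_iff_of_nonneg hnn'] at h4
  refine ⟨w, by simpa using hw, by omega, fun v hv hvw => h4 v ?_⟩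
  simpa using ⟨hvw, hv⟩

/-- A facet meeting `F` in a simple ridge is simple up to the exceptional vertex `w`. -/
theorem IsFacet.isSimple_or_of_ridge {P F G : Set E} (hP : IsPolytope P) (hF : IsFacet P F)
    (hG : IsFacet P G) (hR : IsFacet F (F ∩ G)) (hRs : IsSimple (F ∩ G)) {w : E}
    (hw : w ∈ vertices P) (hw1 : excessDefect P F w = 1)
    (h0 : ∀ v ∈ vertices P, v ≠ w → excessDefect P F v = 0) :
    IsSimple G ∨ (dim P ≤ 4 ∧ w ∈ G ∧ vertexExcess G w = 1) := by
  have hGp := hG.isPolytope hP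
  have hdF := hF.2.2
  have hdG := hG.2.2
  have hdR := hR.2.2
  have hRG : IsFace G (F ∩ G) := (hF.1.inter hG.1).mono hG.1 Set.inter_subset_right
  -- In `G`, the vertex `v` has `d - 2` edges in the ridge; the remaining ones leave `F`, and `P`
  -- has only defect plus one of those.
  have hdeg : ∀ v ∈ vertices P, v ∈ F → v ∈ G →
      (degree G v : ℤ) ≤ dim G + excessDefect P F v := by
    intro v hv hvF hvG
    have hvG' := hG.1.mem_vertices_of_mem hv hvG
    have h1 := hRG.degree_eq_add hGp hvG' ⟨hvF, hvG⟩
    have h2 := hRs v (hRG.mem_vertices_of_mem hvG' ⟨hvF, hvG⟩)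
    have h3 : nb G v \ (F ∩ G) ⊆ nb P v \ F := by
      rintro u ⟨hu, huF⟩
      have huG := nb_subset _ _ hu
      rw [hG.1.nb_eq hP hvG] at hu
      exact ⟨hu.1, fun h => huF ⟨h, huG⟩⟩
    have h4 := Set.ncard_le_ncard h3 (hP.finite_nb v).sdiff
    rw [excessDefect, if_pos hvF]
    omega
  have hne : ∀ v ∈ vertices G, v ≠ w → vertexExcess G v = 0 := by
    intro v hv hvw
    rw [hG.1.vertices_eq] at hv
    have hvG' := hG.1.mem_vertices_of_mem hv.2 hv.1
    have h1 := h0 v hv.2 hvw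
    by_cases hvF : v ∈ F
    · have h2 := hdeg v hv.2 hvF hv.1
      have h3 := hGp.dim_le_degree hvG'
      rw [vertexExcess_eq_zero_iff]
      omega
    · rw [excessDefect, if_neg hvF, vertexExcess_eq_zero_iff] at h1
      rw [vertexExcess_eq_zero_iff]
      exact hG.1.degree_eq_dim hP hv.2 hv.1 h1
  by_contra hcon
  push Not at hcon
  obtain ⟨hns, hcon⟩ := hcon
  have hns' := hns
  unfold IsSimple at hns'
  push Not at hns'
  obtain ⟨v, hv, hvd⟩ := hns'
  have hvw : v = w := by
    by_contra h
    exact hvd (vertexExcess_eq_zero_iff.1 (hne v hv h))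
  rw [hvw] at hv hvd
  have hwG := hv.1
  have h1 : vertexExcess G w ≤ 1 := by
    by_cases hwF : w ∈ F
    · have := hdeg w hw hwF hwG
      unfold vertexExcess
      omega
    · rw [excessDefect, if_neg hwF] at hw1
      have h2 := hG.vertexExcess_eq hP hw hwG
      have h3 := hG.excessDefect_nonneg hP hw
      omega
  have h2 := hGp.vertexExcess_nonneg hv
  have h3 : vertexExcess G w ≠ 0 := fun h => hvd (vertexExcess_eq_zero_iff.1 h)
  -- All excess of `G` sits at `w` and is at most one, while a nonsimple `G` has excess at least `d
  -- - 3`; hence `d ≤ 4`.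
  have h4 : excess G = vertexExcess G w := by
    rw [hGp.excess_eq_sum]
    refine Finset.sum_eq_single w (fun u hu huw => hne u (by simpa using hu) huw) fun h => ?_
    exact absurd (by simpa using hv) h
  have h5 := hGp.le_excess hns
  exact hcon (by omega) hwG (by omega)

/-- Two simple facets over ridges of a facet `F` that meet in low dimension meet in low dimension
themselves. -/
theorem IsFacet.dim_inter_of_ridges {P F G H : Set E} (hP : IsPolytope P) (hF : IsFacet P F)
    (hG : IsFacet P G) (hH : IsFacet P H) (hRG : IsFacet F (F ∩ G))
    (hGs : IsSimple G) (hRGs : IsSimple (F ∩ G)) {z : E}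
    (hz : z ∈ vertices P) (hzF : z ∈ F) (hzG : z ∈ G) (hzH : z ∈ H)
    (hd : dim ((F ∩ G) ∩ (F ∩ H)) + 4 ≤ dim P) : dim (G ∩ H) + 3 ≤ dim P := by
  have hGp := hG.isPolytope hP
  have hzG' := hG.1.mem_vertices_of_mem hz hzG
  have hRG' : IsFace G (F ∩ G) := (hF.1.inter hG.1).mono hG.1 Set.inter_subset_right
  have hRp := hRG'.isPolytope hGp
  have hzR := hRG'.mem_vertices_of_mem hzG' ⟨hzF, hzG⟩
  have hGH := hG.1.inter hH.1
  have hKP := (hF.1.inter hG.1).inter (hF.1.inter hH.1)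
  have hK : IsFace (F ∩ G) ((F ∩ G) ∩ (F ∩ H)) :=
    hKP.mono (hF.1.inter hG.1) Set.inter_subset_left
  have hKp := hK.isPolytope hRp
  have hzK : z ∈ (F ∩ G) ∩ (F ∩ H) := ⟨⟨hzF, hzG⟩, hzF, hzH⟩
  have h1 := hK.degree_eq_dim hRp hzR hzK (hRGs z hzR)
  rw [hKp.degree_eq_ncard_nb (hK.mem_vertices_of_mem hzR hzK)] at h1
  have h2 := hRG'.degree_eq_add hGp hzG' ⟨hzF, hzG⟩
  have h3 := hRGs z hzR
  have h4 := hGs z hzG'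
  have hzGH := hGH.mem_vertices_of_mem hz ⟨hzG, hzH⟩
  have h5 := (hGH.isPolytope hP).dim_le_degree hzGH
  rw [(hGH.isPolytope hP).degree_eq_ncard_nb hzGH] at h5
  -- A neighbour of `z` in `G ∩ H` lies in `F` or is the single neighbour in `G` off the ridge, so
  -- the dimension grows by at most one.
  have hsub : nb (G ∩ H) z ⊆ nb ((F ∩ G) ∩ (F ∩ H)) z ∪ (nb G z \ (F ∩ G)) := by
    intro u hu
    have hu' := nb_subset _ _ hu
    rw [hGH.nb_eq hP ⟨hzG, hzH⟩] at hu
    by_cases huF : u ∈ F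
    · left
      rw [hKP.nb_eq hP hzK]
      exact ⟨hu.1, ⟨huF, hu'.1⟩, huF, hu'.2⟩
    · right
      rw [hG.1.nb_eq hP hzG]
      exact ⟨⟨hu.1, hu'.1⟩, fun h => huF h.1⟩
  have h6 := Set.ncard_le_ncard hsub ((hKp.finite_nb z).union (hGp.finite_nb z).sdiff)
  have h7 := Set.ncard_union_le (nb ((F ∩ G) ∩ (F ∩ H)) z) (nb G z \ (F ∩ G))
  have h8 := hG.2.2
  have h9 := hF.2.2
  have h10 := hRG.2.2
  omega

theorem IsPolytope.ncard_nb_le_two {P : Set E} (hP : IsPolytope P) (h : dim P ≤ 2) {v : E}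
    (hv : v ∈ vertices P) : (nb P v).ncard ≤ 2 :=
  hP.degree_eq_ncard_nb hv ▸ hP.degree_le_two h hv

/-- In dimension four, of two facets over ridges with a common edge at least one avoids having
excess one at the exceptional vertex. -/
theorem IsFacet.false_of_adjacent_ridges {P F G H : Set E} (hP : IsPolytope P) (h4 : dim P = 4)
    (hF : IsFacet P F) (hG : IsFacet P G) (hH : IsFacet P H) (hRG : IsFacet F (F ∩ G))
    (hRH : IsFacet F (F ∩ H)) (hGH : G ≠ H) {w z x : E} (hw : w ∈ vertices P)
    (hw1 : excessDefect P F w = 1) (hzw : w ∈ F → z = w) (hx : x ∈ nb F z) (hxG : x ∈ G)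
    (hxH : x ∈ H) (hwG : w ∈ G) (hwH : w ∈ H) (hwG1 : vertexExcess G w = 1)
    (hwH1 : vertexExcess H w = 1) : False := by
  have hGp := hG.isPolytope hP
  have hHp := hH.isPolytope hP
  have hI := hG.1.inter hH.1
  have hdG := hG.2.2
  have hdH := hH.2.2
  have hdF := hF.2.2
  have hdI := hG.dim_inter hH hGH ⟨w, hwG, hwH⟩
  have h2 := (hI.isPolytope hP).ncard_nb_le_two (by omega) (hI.mem_vertices_of_mem hw ⟨hwG, hwH⟩)
  have hwG' := hG.1.mem_vertices_of_mem hw hwG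
  have hwH' := hH.1.mem_vertices_of_mem hw hwH
  -- If `w ∈ F`, then `w = z` and two edges leave `F` at `z`; both `G` and `H` contain them to reach
  -- degree 4, so with `x` the vertex `z` has three neighbours in `G ∩ H`. If `w ∉ F`, its degree is
  -- 5 in `P` and 4 in both `G` and `H`, again giving three common neighbours. But `G ∩ H` is at
  -- most a polygon.
  by_cases hwF : w ∈ F
  · have hzw := hzw hwF
    subst hzw
    rw [excessDefect, if_pos hwF] at hw1
    have key : ∀ {A : Set E}, IsFacet P A → IsFacet F (F ∩ A) → z ∈ A → vertexExcess A z = 1 →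
        nb P z \ F ⊆ A := by
      intro A hA hRA hzA hA1
      have hAp := hA.isPolytope hP
      have hzA' := hA.1.mem_vertices_of_mem hw hzA
      have hRA' : IsFace A (F ∩ A) := (hF.1.inter hA.1).mono hA.1 Set.inter_subset_right
      have e1 := hRA'.degree_eq_add hAp hzA' ⟨hwF, hzA⟩
      have hdR := hRA.2.2
      have hdA := hA.2.2
      have e2 := (hRA'.isPolytope hAp).isSimple_of_dim_le_two (by omega) z
        (hRA'.mem_vertices_of_mem hzA' ⟨hwF, hzA⟩)
      have hsub : nb A z \ (F ∩ A) ⊆ nb P z \ F := by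
        rintro u ⟨hu, huF⟩
        have huA := nb_subset _ _ hu
        rw [hA.1.nb_eq hP hzA] at hu
        exact ⟨hu.1, fun h => huF ⟨h, huA⟩⟩
      unfold vertexExcess at hA1
      have heq := Set.eq_of_subset_of_ncard_le hsub (by omega) (hP.finite_nb z).sdiff
      rw [← heq]
      exact fun u hu => nb_subset _ _ hu.1
    have hG' := key hG hRG hwG hwG1
    have hH' := key hH hRH hwH hwH1
    have hsub : insert x (nb P z \ F) ⊆ nb (G ∩ H) z := by
      rw [hI.nb_eq hP ⟨hwG, hwH⟩]
      rw [hF.1.nb_eq hP hwF] at hx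
      rintro u (rfl | hu)
      · exact ⟨hx.1, hxG, hxH⟩
      · exact ⟨hu.1, hG' hu, hH' hu⟩
    have e1 := Set.ncard_le_ncard hsub ((hI.isPolytope hP).finite_nb z)
    rw [Set.ncard_insert_of_notMem (fun h => h.2 (nb_subset _ _ hx)) (hP.finite_nb z).sdiff] at e1
    omega
  · rw [excessDefect, if_neg hwF] at hw1
    unfold vertexExcess at hw1 hwG1 hwH1
    rw [hP.degree_eq_ncard_nb hw] at hw1
    rw [hGp.degree_eq_ncard_nb hwG'] at hwG1
    rw [hHp.degree_eq_ncard_nb hwH'] at hwH1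
    rw [hG.1.inter_nb hP hH.1 hwG hwH] at h2
    have e1 := Set.ncard_union_add_ncard_inter (nb G w) (nb H w) (hGp.finite_nb w)
      (hHp.finite_nb w)
    have e2 : nb G w ∪ nb H w ⊆ nb P w := by
      rw [hG.1.nb_eq hP hwG, hH.1.nb_eq hP hwH]
      exact Set.union_subset Set.inter_subset_left Set.inter_subset_left
    have e3 := Set.ncard_le_ncard e2 (hP.finite_nb w)
    omega

theorem Adjacent.eq_of_mem_segment {P : Set E} {v u w : E} (hu : Adjacent P v u)
    (hw : Adjacent P v w) (h : w ∈ segment ℝ v u) : w = u := by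
  have h1 := hu.isFace.mem_vertices_of_mem hw.right_mem_vertices h
  rw [vertices_segment hu.2.2] at h1
  rcases h1 with h1 | h1
  · exact absurd h1.symm hw.1
  · exact h1

/-- At a vertex of degree four of a `3`-polytope, two opposite `2`-faces `R`, `S` determine another
pair of opposite `2`-faces, each of which shares an edge with each of `R`, `S`. -/
theorem IsFacet.exists_opposite_pair {Q R S : Set E} (hQ : IsPolytope Q) (h3 : dim Q = 3)
    (hR : IsFacet Q R) (hS : IsFacet Q S) {z : E} (hz : z ∈ vertices Q) (hzR : z ∈ R) (hzS : z ∈ S)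
    (h4 : degree Q z = 4) (h0 : dim (R ∩ S) = 0) :
    ∃ T U, IsFacet Q T ∧ IsFacet Q U ∧ T ≠ U ∧ z ∈ T ∧ z ∈ U ∧ dim (T ∩ U) = 0 ∧
      T ≠ R ∧ U ≠ R ∧ T ≠ S ∧ U ≠ S ∧
      (nb Q z ∩ R ∩ T).Nonempty ∧ (nb Q z ∩ R ∩ U).Nonempty ∧
      (nb Q z ∩ S ∩ T).Nonempty ∧ (nb Q z ∩ S ∩ U).Nonempty := by
  have hnb2 : ∀ {A : Set E}, IsFacet Q A → z ∈ A → (nb A z).ncard = 2 := by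
    intro A hA hzA
    have hAp := hA.isPolytope hQ
    have := hA.2.2
    have hzA' := hA.1.mem_vertices_of_mem hz hzA
    rw [← hAp.degree_eq_ncard_nb hzA', hAp.isSimple_of_dim_le_two (by omega) z hzA']
    omega
  have hRp := hR.isPolytope hQ
  have hSp := hS.isPolytope hQ
  have hI := hR.1.inter hS.1
  have hIp := hI.isPolytope hQ
  have hzI := hI.mem_vertices_of_mem hz ⟨hzR, hzS⟩
  have hdisj : nb R z ∩ nb S z = ∅ := by
    rw [← hR.1.inter_nb hQ hS.1 hzR hzS, ← Set.ncard_eq_zero (hIp.finite_nb z),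
      ← hIp.degree_eq_ncard_nb hzI, hIp.isSimple_of_dim_le_two (by omega) z hzI, h0]
  -- The two neighbours in `R` and the two in `S` are disjoint, so they are all four neighbours of
  -- `z`.
  have hunion : nb Q z ⊆ nb R z ∪ nb S z := by
    have hsub : nb R z ∪ nb S z ⊆ nb Q z := by
      rw [hR.1.nb_eq hQ hzR, hS.1.nb_eq hQ hzS]
      exact Set.union_subset Set.inter_subset_left Set.inter_subset_left
    refine (Set.eq_of_subset_of_ncard_le hsub ?_ (hQ.finite_nb z)).ge
    have := Set.ncard_union_add_ncard_inter (nb R z) (nb S z) (hRp.finite_nb z) (hSp.finite_nb z)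
    rw [hdisj, Set.ncard_empty, hnb2 hR hzR, hnb2 hS hzS] at this
    rw [← hQ.degree_eq_ncard_nb hz]
    omega
  obtain ⟨c, d, hcd, hRcd⟩ := Set.ncard_eq_two.1 (hnb2 hR hzR)
  -- `T` and `U` will be the facets on the other side of the two edges of `R` at `z`; the second
  -- edge of each at `z` must then lie in `S`.
  have hother : ∀ c ∈ nb R z, ∃ T, IsFacet Q T ∧ T ≠ R ∧ R ∩ T = segment ℝ z c := by
    intro c hc
    refine hR.exists_other hQ ⟨hc.isFace, ⟨z, left_mem_segment ℝ z c⟩, ?_⟩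
    rw [hc.2.2]
    have := hR.2.2
    omega
  have hc : c ∈ nb R z := by rw [hRcd]; simp
  have hd : d ∈ nb R z := by rw [hRcd]; simp
  have hcQ : c ∈ nb Q z := by rw [hR.1.nb_eq hQ hzR] at hc; exact hc.1
  have hdQ : d ∈ nb Q z := by rw [hR.1.nb_eq hQ hzR] at hd; exact hd.1
  have hcR := nb_subset _ _ hc
  have hdR := nb_subset _ _ hd
  obtain ⟨T, hT, hTR, hRT⟩ := hother c hc
  obtain ⟨U, hU, hUR, hRU⟩ := hother d hd
  have hzT : z ∈ T := (hRT.symm ▸ left_mem_segment ℝ z c : z ∈ R ∩ T).2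
  have hcT : c ∈ T := (hRT.symm ▸ right_mem_segment ℝ z c : c ∈ R ∩ T).2
  have hzU : z ∈ U := (hRU.symm ▸ left_mem_segment ℝ z d : z ∈ R ∩ U).2
  have hdU : d ∈ U := (hRU.symm ▸ right_mem_segment ℝ z d : d ∈ R ∩ U).2
  have hdT : d ∉ T := fun h =>
    hcd (Adjacent.eq_of_mem_segment hc hd (hRT ▸ ⟨hdR, h⟩)).symm
  have hcU : c ∉ U := fun h => hcd (Adjacent.eq_of_mem_segment hd hc (hRU ▸ ⟨hcR, h⟩))
  have hTU : T ≠ U := fun h => hcU (h ▸ hcT)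
  have hnotS : ∀ y ∈ nb R z, y ∉ S := by
    intro y hy hyS
    have : y ∈ nb R z ∩ nb S z := by
      refine ⟨hy, ?_⟩
      rw [hS.1.nb_eq hQ hzS]
      rw [hR.1.nb_eq hQ hzR] at hy
      exact ⟨hy.1, hyS⟩
    rw [hdisj] at this
    exact this
  have hTS : T ≠ S := fun h => hnotS c hc (h ▸ hcT)
  have hUS : U ≠ S := fun h => hnotS d hd (h ▸ hdU)
  have hsecond : ∀ {A : Set E} {a b : E}, IsFacet Q A → z ∈ A → nb R z = {a, b} → b ∉ A →
      (nb Q z ∩ S ∩ A).Nonempty := by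
    intro A a b hA hzA hab hbA
    obtain ⟨x, hx, hxa⟩ := Set.exists_ne_of_one_lt_ncard
      (show 1 < (nb A z).ncard by rw [hnb2 hA hzA]; exact one_lt_two) a
    have hxA := nb_subset _ _ hx
    rw [hA.1.nb_eq hQ hzA] at hx
    rcases hunion hx.1 with h | h
    · rw [hab] at h
      rcases h with h | h
      · exact absurd h hxa
      · exact absurd (h ▸ hxA) hbA
    · exact ⟨x, ⟨hx.1, nb_subset _ _ h⟩, hxA⟩
  refine ⟨T, U, hT, hU, hTU, hzT, hzU, ?_, hTR, hUR, hTS, hUS, ⟨c, ⟨hcQ, hcR⟩, hcT⟩,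
    ⟨d, ⟨hdQ, hdR⟩, hdU⟩, hsecond hT hzT hRcd hdT,
    hsecond hU hzU (by rw [hRcd, Set.pair_comm]) hcU⟩
  -- A common edge of `T` and `U` at `z` cannot lie in `R`, and in `S` it would be a ridge in the
  -- three facets `S`, `T`, `U`.
  by_contra hne
  have hJ := hT.1.inter hU.1
  obtain ⟨y, hy⟩ := (hJ.isPolytope hQ).exists_edge hne (hJ.mem_vertices_of_mem hz ⟨hzT, hzU⟩)
  have hyTU := nb_subset _ _ hy
  rw [hJ.nb_eq hQ ⟨hzT, hzU⟩] at hy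
  rcases hunion hy.1 with h | h
  · rw [hRcd] at h
    rcases h with rfl | h
    · exact hcU hyTU.2
    · rw [Set.mem_singleton_iff] at h
      exact hdT (h ▸ hyTU.1)
  · have hseg : IsFacet S (segment ℝ z y) :=
      ⟨h.isFace, ⟨z, left_mem_segment ℝ z y⟩, by
        rw [h.2.2]
        have := hS.2.2
        omega⟩
    exact hTU (hS.ridge_unique hT hU hseg
      ((IsExposed.convex hT.1 hQ.convex).segment_subset hzT hyTU.1)
      ((IsExposed.convex hU.1 hQ.convex).segment_subset hzU hyTU.2) hTS.symm hUS.symm)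

/-- A `d`-polytope of excess `d - 2` has two simple facets whose intersection is nonempty and of
dimension at most `d - 3`. -/
theorem IsPolytope.exists_simple_facets {P : Set E} (hP : IsPolytope P) (hd : 3 ≤ dim P)
    (hex : excess P = (dim P : ℤ) - 2) : ∃ G H, IsFacet P G ∧ IsFacet P H ∧ G ≠ H ∧
      IsSimple G ∧ IsSimple H ∧ (G ∩ H).Nonempty ∧ dim (G ∩ H) + 3 ≤ dim P := by
  induction hn : dim P generalizing P with
  | zero => omega
  | succ n ih =>
  rw [← hn]
  by_cases hs : ∀ F, IsFacet P F → IsSimple F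
  · have hns : ¬ IsSimple P := fun h => by
      have := h.excess_eq_zero hP
      omega
    unfold IsSimple at hns
    push Not at hns
    obtain ⟨v, hv, hvd⟩ := hns
    obtain ⟨F, G, hF, hG, hFG, hvF, hvG, hdim⟩ :=
      hP.exists_facets_of_not_simple (by omega) hs hv hvd
    exact ⟨F, G, hF, hG, hFG, hs F hF, hs G hG, ⟨v, hvF, hvG⟩, hdim⟩
  push Not at hs
  obtain ⟨F, hF, hFs⟩ := hs
  have hFp := hF.isPolytope hP
  have hdF := hF.2.2
  have hF3 : 3 ≤ dim F := by
    by_contra h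
    exact hFs (hFp.isSimple_of_dim_le_two (by omega))
  have hexF := hF.excess_eq_of_not_isSimple hP hFs hex
  obtain ⟨w, hw, hw1, hw0⟩ := hF.exists_excessDefect hP (by omega)
  have hexF' : excess F = (dim F : ℤ) - 2 := by omega
  obtain ⟨R, S, hR, hS, hRS, hRs, hSs, hRSne, hRSd⟩ := ih hFp hF3 hexF' (by omega)
  replace hRSd : dim (R ∩ S) + 3 ≤ dim F := by omega
  obtain ⟨-, hnsV, -, hvex⟩ := (hR.le_excess_of_inter hFp hS hRs hSs hRSne hRSd).2 hexF'
  obtain ⟨z, hzRS⟩ := ((hR.1.inter hS.1).isPolytope hFp).vertices_nonempty hRSne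
  have hzns : z ∈ nonsimpleVertices F := by rw [hnsV]; exact hzRS
  have hzR := (vertices_subset hzRS).1
  have hzS := (vertices_subset hzRS).2
  have hzF := hzns.1
  have hzP : z ∈ vertices P := by rw [hF.1.vertices_eq] at hzF; exact hzF.2
  -- If `w ∈ F`, all vertices off `F` are simple, so `w` is the only vertex that can be nonsimple.
  have hzw : w ∈ F → z = w := by
    intro hwF
    by_contra hne
    refine hzns.2 (hF.1.degree_eq_dim hP hzP hzF.1 (hF.degree_eq_dim_of_excessDefect hP hzP
      (hw0 z hzP hne) fun u hu huF => hw0 u (nb_subset_vertices _ _ hu) ?_))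
    rintro rfl
    exact huF hwF
  have finish : ∀ {R S G H : Set E}, IsFacet F R → IsFacet F S → R ≠ S → IsSimple R → z ∈ R →
      z ∈ S → dim (R ∩ S) + 3 ≤ dim F → IsFacet P G → IsFacet P H → F ∩ G = R → F ∩ H = S →
      IsSimple G → IsSimple H → ∃ G H, IsFacet P G ∧ IsFacet P H ∧ G ≠ H ∧
      IsSimple G ∧ IsSimple H ∧ (G ∩ H).Nonempty ∧ dim (G ∩ H) + 3 ≤ dim P := by
    rintro R S G H hR hS hRS hRs hzR hzS hRSd hG hH rfl rfl hGs hHs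
    refine ⟨G, H, hG, hH, fun h => hRS (by rw [h]), hGs, hHs, ⟨z, hzR.2, hzS.2⟩, ?_⟩
    exact hF.dim_inter_of_ridges hP hG hH hR hGs hRs hzP hzF.1 hzR.2 hzS.2 (by omega)
  obtain ⟨G, hG, -, hFG⟩ := hF.exists_other hP hR
  obtain ⟨H, hH, -, hFH⟩ := hF.exists_other hP hS
  have hG' := hF.isSimple_or_of_ridge hP hG (hFG.symm ▸ hR) (hFG.symm ▸ hRs) hw hw1 hw0
  have hH' := hF.isSimple_or_of_ridge hP hH (hFH.symm ▸ hS) (hFH.symm ▸ hSs) hw hw1 hw0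
  by_cases hboth : IsSimple G ∧ IsSimple H
  · exact finish hR hS hRS hRs hzR hzS hRSd hG hH hFG hFH hboth.1 hboth.2
  have h4 : dim P = 4 := by
    rcases hG' with h | h
    · rcases hH' with h' | h'
      · exact absurd ⟨h, h'⟩ hboth
      · omega
    · omega
  have hz4 : degree F z = 4 := by
    have := hvex z hzRS
    unfold vertexExcess at this
    omega
  -- One of `G`, `H` is nonsimple, and its ridge shares an edge at `z` with both `T` and `U`. Facets
  -- over ridges with a common edge are not both nonsimple, so those over `T` and `U` are simple.
  obtain ⟨T, U, hT, hU, hTU, hzT, hzU, hTU0, hTR, hUR, hTS, hUS, hxRT, hxRU, hxST, hxSU⟩ :=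
    hR.exists_opposite_pair hFp (by omega) hS hzF hzR hzS hz4 (by omega)
  have hsimp2 : ∀ {A : Set E}, IsFacet F A → IsSimple A := fun {A} hA =>
    (hA.isPolytope hFp).isSimple_of_dim_le_two (by have := hA.2.2; omega)
  obtain ⟨A, hA, -, hFA⟩ := hF.exists_other hP hT
  obtain ⟨B, hB, -, hFB⟩ := hF.exists_other hP hU
  have hadj : ∀ {X Y R T : Set E}, IsFacet P X → IsFacet P Y → IsFacet F R → IsFacet F T →
      F ∩ X = R → F ∩ Y = T → T ≠ R → (nb F z ∩ R ∩ T).Nonempty → ¬ IsSimple X → IsSimple Y := by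
    rintro X Y R T hX hY hR hT rfl rfl hRT ⟨x, ⟨hx, hxX⟩, hxY⟩ hXs
    rcases hF.isSimple_or_of_ridge hP hY hT (hsimp2 hT) hw hw1 hw0 with h | h
    · exact h
    rcases hF.isSimple_or_of_ridge hP hX hR (hsimp2 hR) hw hw1 hw0 with h' | h'
    · exact absurd h' hXs
    exact (hF.false_of_adjacent_ridges hP h4 hX hY hR hT (fun h => hRT (by rw [h])) hw hw1 hzw hx
      hxX.2 hxY.2 h'.2.1 h.2.1 h'.2.2 h.2.2).elim
  have hAB : IsSimple A ∧ IsSimple B := by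
    by_cases hGs : IsSimple G
    · have hHs : ¬ IsSimple H := fun h => hboth ⟨hGs, h⟩
      exact ⟨hadj hH hA hS hT hFH hFA hTS hxST hHs, hadj hH hB hS hU hFH hFB hUS hxSU hHs⟩
    · exact ⟨hadj hG hA hR hT hFG hFA hTR hxRT hGs, hadj hG hB hR hU hFG hFB hUR hxRU hGs⟩
  exact finish hT hU hTU (hsimp2 hT) hzT hzU (by omega) hA hB hFA hFB hAB.1 hAB.2

/-- For `d ≥ 4`, a `d`-polytope of excess `d - 2` has a nonsimple facet. -/
theorem IsPolytope.exists_not_isSimple_facet {P : Set E} (hP : IsPolytope P) (hd : 4 ≤ dim P)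
    (hex : excess P = (dim P : ℤ) - 2) : ∃ F, IsFacet P F ∧ ¬ IsSimple F := by
  by_contra hcon
  push Not at hcon
  obtain ⟨G, H, hG, hH, hGH, hGs, hHs, hne, hdim⟩ := hP.exists_simple_facets (by omega) hex
  obtain ⟨hj, hns, hcard, hvex⟩ := (hG.le_excess_of_inter hP hH hGs hHs hne hdim).2 hex
  have hI := hG.1.inter hH.1
  have hIp := hI.isPolytope hP
  have hGp := hG.isPolytope hP
  have hHp := hH.isPolytope hP
  obtain ⟨v, hvI⟩ := hIp.vertices_nonempty hne
  have hvG := (vertices_subset hvI).1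
  have hvH := (vertices_subset hvI).2
  have hv : v ∈ vertices P := by rw [hI.vertices_eq] at hvI; exact hvI.2
  have hdG := hG.2.2
  have hdH := hH.2.2
  have hnbn : ∀ {A : Set E}, IsFace P A → v ∈ A → IsSimple A → (nb A v).ncard = dim A := by
    intro A hA hvA hAs
    rw [← (hA.isPolytope hP).degree_eq_ncard_nb (hA.mem_vertices_of_mem hv hvA)]
    exact hAs v (hA.mem_vertices_of_mem hv hvA)
  have hinter : ∀ {A B : Set E}, IsFacet P A → IsFacet P B → v ∈ A → v ∈ B →
      (nb A v ∩ nb B v).ncard = dim (A ∩ B) := by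
    intro A B hA hB hvA hvB
    have hAB := hA.1.inter hB.1
    have hABA : IsFace A (A ∩ B) := hAB.mono hA.1 Set.inter_subset_left
    have hvA' := hA.1.mem_vertices_of_mem hv hvA
    rw [← hA.1.inter_nb hP hB.1 hvA hvB, ← (hAB.isPolytope hP).degree_eq_ncard_nb
      (hAB.mem_vertices_of_mem hv ⟨hvA, hvB⟩)]
    exact hABA.degree_eq_dim (hA.isPolytope hP) hvA' ⟨hvA, hvB⟩ (hcon A hA v hvA')
  -- Two facets through `v` not meeting in a ridge meet in the hull of the nonsimple vertices, that
  -- is, in `G ∩ H`.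
  have hpair : ∀ {A B : Set E}, IsFacet P A → IsFacet P B → v ∈ A → v ∈ B → A ≠ B →
      dim (A ∩ B) + 2 = dim P ∨
        (dim (A ∩ B) = dim (G ∩ H) ∧ nb (A ∩ B) v = nb (G ∩ H) v) := by
    intro A B hA hB hvA hvB hAB
    have h1 := hA.dim_inter hB hAB ⟨v, hvA, hvB⟩
    by_cases h2 : dim (A ∩ B) + 2 = dim P
    · exact Or.inl h2
    · right
      obtain ⟨-, hns', hcard', -⟩ := (hA.le_excess_of_inter hP hB (hcon A hA) (hcon B hB)
        ⟨v, hvA, hvB⟩ (by omega)).2 hex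
      rw [hns] at hns'
      rw [← hns', hcard] at hcard'
      refine ⟨by omega, ?_⟩
      rw [((hA.1.inter hB.1).isPolytope hP).eq_convexHull_vertices, ← hns',
        ← hIp.eq_convexHull_vertices]
  have hcGH := hinter hG hH hvG hvH
  have hcG := hnbn hG.1 hvG hGs
  have hcH := hnbn hH.1 hvH hHs
  -- Equality in the excess bound means that every edge at `v` lies in `G` or `H`.
  have hdeg : nb P v = nb G v ∪ nb H v := by
    have hsub : nb G v ∪ nb H v ⊆ nb P v := by
      rw [hG.1.nb_eq hP hvG, hH.1.nb_eq hP hvH]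
      exact Set.union_subset Set.inter_subset_left Set.inter_subset_left
    refine (Set.eq_of_subset_of_ncard_le hsub ?_ (hP.finite_nb v)).symm
    have h1 := hvex v hvI
    unfold vertexExcess at h1
    rw [hP.degree_eq_ncard_nb hv] at h1
    have h2 := Set.ncard_union_add_ncard_inter (nb G v) (nb H v) (hGp.finite_nb v)
      (hHp.finite_nb v)
    omega
  -- A third facet through `v` meets `G` and `H` in ridges: if it met one only in `G ∩ H`, all its
  -- edges at `v` would lie in the other. Counting, `d - 3` of its neighbours of `v` lie in `G ∩ H`,
  -- which has at most that many. So every facet through `v` contains all neighbours of `v` in `G ∩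
  -- H`, which is absurd once there is one.
  have hthird : ∀ {F : Set E}, IsFacet P F → v ∈ F → F ≠ G → F ≠ H →
      (nb F v ∩ nb G v).ncard + 2 = dim P ∧ (nb F v ∩ nb H v).ncard + 2 = dim P ∧
      (nb F v).ncard + (nb F v ∩ nb (G ∩ H) v).ncard + 4 = 2 * dim P := by
    intro F hF hvF hFG hFH
    have hFp := hF.isPolytope hP
    have hdF := hF.2.2
    have hcF := hnbn hF.1 hvF (hcon F hF)
    have c1 := hinter hF hG hvF hvG
    have c2 := hinter hF hH hvF hvH
    have hsubF : nb F v ⊆ nb G v ∪ nb H v := by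
      rw [← hdeg, hF.1.nb_eq hP hvF]; exact Set.inter_subset_left
    have hU : nb F v = (nb F v ∩ nb G v) ∪ (nb F v ∩ nb H v) := by
      rw [← Set.inter_union_distrib_left, Set.inter_eq_left.2 hsubF]
    have hI2 : nb F v ∩ nb (G ∩ H) v = (nb F v ∩ nb G v) ∩ (nb F v ∩ nb H v) := by
      rw [hG.1.inter_nb hP hH.1 hvG hvH, ← Set.inter_inter_distrib_left]
    have hcount := Set.ncard_union_add_ncard_inter (nb F v ∩ nb G v) (nb F v ∩ nb H v)
      ((hFp.finite_nb v).inter_of_left _) ((hFp.finite_nb v).inter_of_left _)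
    rw [← hU, ← hI2] at hcount
    have hlow : ∀ {A B : Set E}, IsFacet P A → IsFacet P B → v ∈ A → v ∈ B → F ≠ A → F ≠ B →
        nb P v = nb A v ∪ nb B v → nb (A ∩ B) v = nb (G ∩ H) v → dim (F ∩ A) + 2 = dim P := by
      intro A B hA hB hvA hvB hFA hFB hPAB hABGH
      rcases hpair hF hA hvF hvA hFA with h | ⟨-, h⟩
      · exact h
      · exfalso
        refine hF.not_subset hB hFB (hF.1.subset_of_nb_subset hP hB.1 hv hvF hvB ?_)
        intro u hu
        have huP : u ∈ nb P v := by rw [hF.1.nb_eq hP hvF] at hu; exact hu.1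
        rw [hPAB] at huP
        rcases huP with huA | huB
        · have h1 : u ∈ nb (F ∩ A) v := by
            rw [hF.1.inter_nb hP hA.1 hvF hvA]; exact ⟨hu, huA⟩
          rw [h, ← hABGH] at h1
          exact (nb_subset _ _ h1).2
        · exact nb_subset _ _ huB
    have l1 := hlow hG hH hvG hvH hFG hFH hdeg rfl
    have l2 := hlow hH hG hvH hvG hFH hFG (by rw [hdeg, Set.union_comm])
      (by rw [Set.inter_comm])
    refine ⟨by omega, by omega, by omega⟩
  have hnI : (nb (G ∩ H) v).ncard = dim (G ∩ H) := by
    rw [hG.1.inter_nb hP hH.1 hvG hvH, hcGH]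
  have hall : ∀ {F : Set E}, IsFacet P F → v ∈ F → nb (G ∩ H) v ⊆ F ∧
      (F ≠ G → F ≠ H → dim (G ∩ H) + 3 = dim P) := by
    intro F hF hvF
    by_cases hFG : F = G
    · exact ⟨hFG ▸ (nb_subset _ _).trans Set.inter_subset_left, fun h => absurd hFG h⟩
    by_cases hFH : F = H
    · exact ⟨hFH ▸ (nb_subset _ _).trans Set.inter_subset_right, fun _ h => absurd hFH h⟩
    obtain ⟨-, -, h3⟩ := hthird hF hvF hFG hFH
    have hcF := hnbn hF.1 hvF (hcon F hF)
    have hdF := hF.2.2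
    have h4 := Set.ncard_le_ncard (Set.inter_subset_right (s := nb F v) (t := nb (G ∩ H) v))
      (hIp.finite_nb v)
    have h5 := Set.eq_of_subset_of_ncard_le
      (Set.inter_subset_right (s := nb F v) (t := nb (G ∩ H) v)) (by omega) (hIp.finite_nb v)
    refine ⟨?_, fun _ _ => by omega⟩
    rw [← h5]
    exact fun u hu => nb_subset _ _ hu.1
  obtain ⟨a, ha, haH⟩ := hG.1.exists_nb_notMem hP hH.1 hv hvG hvH (hG.not_subset hH hGH)
  obtain ⟨b, hb, hba⟩ := Set.exists_ne_of_one_lt_ncard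
    (show 1 < (nb G v).ncard by omega) a
  have haP : a ∈ nb P v := by rw [hG.1.nb_eq hP hvG] at ha; exact ha.1
  have hbP : b ∈ nb P v := by rw [hG.1.nb_eq hP hvG] at hb; exact hb.1
  -- This `F` differs from `G` by `b` and from `H` by `a`. As a third facet it gives `dim (G ∩ H) =
  -- d - 3 ≥ 1`.
  obtain ⟨F, hF, hFsub, hbF⟩ := hP.exists_isFacet_notMem haP.isFace
    ⟨v, left_mem_segment ℝ v a⟩ (nb_subset _ _ hbP)
    fun h => hba (Adjacent.eq_of_mem_segment haP hbP h)
  have hj3 := (hall hF (hFsub (left_mem_segment ℝ v a))).2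
    (fun h => hbF (h ▸ nb_subset _ _ hb)) (fun h => haH (h ▸ hFsub (right_mem_segment ℝ v a)))
  obtain ⟨x, hx⟩ := Set.nonempty_of_ncard_ne_zero (show (nb (G ∩ H) v).ncard ≠ 0 by omega)
  have hxP : x ∈ nb P v := by rw [hI.nb_eq hP ⟨hvG, hvH⟩] at hx; exact hx.1
  obtain ⟨K, hK, hvK, hxK⟩ := hP.exists_isFacet_notMem (hP.isFace_singleton hv)
    (Set.singleton_nonempty v) (nb_subset _ _ hxP) (Ne.symm hxP.1)
  exact hxK ((hall hK (by simpa using hvK)).1 hx)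

end FiniteDimensional

/-! ### Decomposability of Shephard polytopes -/

section FiniteDimensional

variable [FiniteDimensional ℝ E]

/-- A map of the vertices that rescales all edges by nonnegative factors preserves the property of
maximizing a linear functional. -/
theorem IsPolytope.map_le_of_parallel {P : Set E} (hP : IsPolytope P) {ψ : E → E}
    (hψ : ∀ v u, Adjacent P v u → ∃ k : ℝ, 0 ≤ k ∧ ψ u - ψ v = k • (u - v)) {v : E}
    (hv : v ∈ vertices P) (m : E →ₗ[ℝ] ℝ) (hm : ∀ x ∈ P, m x ≤ m v) {w : E}
    (hw : w ∈ vertices P) : m (ψ w) ≤ m (ψ v) := by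
  -- If `m` is maximal only at `v`, take the highest counterexample; an edge ascending from it does
  -- not decrease `m ∘ ψ` and leads to a higher one.
  have huniq : ∀ m : E →ₗ[ℝ] ℝ, (∀ x ∈ P, x ≠ v → m x < m v) →
      ∀ w ∈ vertices P, m (ψ w) ≤ m (ψ v) := by
    intro m hm
    by_contra hcon
    push Not at hcon
    obtain ⟨w, hw, hwv⟩ := hcon
    obtain ⟨w₀, ⟨hw₀, hlt⟩, hmax⟩ := Set.exists_max_image
      {w ∈ vertices P | m (ψ v) < m (ψ w)} m (hP.finite_vertices.subset (Set.sep_subset _ _))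
      ⟨w, hw, hwv⟩
    have hne : w₀ ≠ v := by rintro rfl; exact lt_irrefl _ hlt
    obtain ⟨u, hu, hmu⟩ : ∃ u ∈ nb P w₀, m w₀ < m u := by
      by_contra h
      push Not at h
      exact absurd (hP.le_of_nb hw₀ m h v hv.1) (not_le.2 (hm w₀ hw₀.1 hne))
    obtain ⟨k, hk, hku⟩ := hψ w₀ u hu
    have h1 := congrArg m hku
    rw [map_sub, map_smul, map_sub, smul_eq_mul] at h1
    have h2 := mul_nonneg hk (sub_nonneg.2 hmu.le)
    exact absurd (hmax u ⟨nb_subset_vertices _ _ hu, by linarith⟩) (not_le.2 hmu)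
  obtain ⟨f, c, hf, hfv⟩ := (hP.isFace_singleton hv).exists_functional (Set.singleton_nonempty v)
  have hvc : f v = c := by
    have : v ∈ ({v} : Set E) := rfl
    rw [hfv] at this; exact this.2
  have hfs : ∀ x ∈ P, x ≠ v → f x < f v := by
    intro x hx hxv
    refine lt_of_le_of_ne (hvc ▸ hf x hx) fun h => hxv ?_
    have : x ∈ ({v} : Set E) := by rw [hfv]; exact ⟨hx, h.trans hvc⟩
    exact this
  by_contra hcon
  push Not at hcon
  set D := m (ψ w) - m (ψ v) with hD
  set K := f (ψ v) - f (ψ w) with hK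
  have hD0 : 0 < D := sub_pos.2 hcon
  have hK1 : 0 < |K| + 1 := by positivity
  -- Adding a multiple of `f`, which exposes `v`, makes the maximizer unique; the coefficient is
  -- small enough that `f` cannot make up for the gap `D`.
  have h1 := huniq (m + (D / (|K| + 1)) • f) (fun x hx hxv => by
    have := mul_lt_mul_of_pos_left (hfs x hx hxv) (div_pos hD0 hK1)
    simp only [LinearMap.add_apply, LinearMap.smul_apply, smul_eq_mul]
    linarith [hm x hx]) w hw
  simp only [LinearMap.add_apply, LinearMap.smul_apply, smul_eq_mul] at h1
  have h2 : D ≤ D / (|K| + 1) * K := by rw [hD, hK]; linarith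
  have h3 : D / (|K| + 1) * K < D := by
    rw [div_mul_eq_mul_div, div_lt_iff₀ hK1]
    exact mul_lt_mul_of_pos_left ((le_abs_self K).trans_lt (lt_add_one _)) hD0
  linarith

/-- A functional maximal over `P` at `v` is maximal over the two hulls at `φ v` and `ψ v`, so no
functional separates a point of the sum from `P`. -/
theorem IsPolytope.eq_add_of_parallel {P : Set E} (hP : IsPolytope P) {φ ψ : E → E}
    (hφ : ∀ v u, Adjacent P v u → ∃ k : ℝ, 0 ≤ k ∧ φ u - φ v = k • (u - v))
    (hψ : ∀ v u, Adjacent P v u → ∃ k : ℝ, 0 ≤ k ∧ ψ u - ψ v = k • (u - v))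
    (hsum : ∀ v, φ v + ψ v = v) :
    P = convexHull ℝ (φ '' vertices P) + convexHull ℝ (ψ '' vertices P) := by
  apply Set.Subset.antisymm
  · conv_lhs => rw [hP.eq_convexHull_vertices]
    refine convexHull_min ?_ ((convex_convexHull ℝ _).add (convex_convexHull ℝ _))
    intro v hv
    exact ⟨φ v, subset_convexHull ℝ _ ⟨v, hv, rfl⟩, ψ v, subset_convexHull ℝ _ ⟨v, hv, rfl⟩,
      hsum v⟩
  · rintro _ ⟨q, hq, r, hr, rfl⟩
    by_contra hqr
    obtain ⟨l, u, hl, hu⟩ := geometric_hahn_banach_closed_point hP.convex hP.isCompact.isClosed hqr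
    have hne : (vertices P).Nonempty := by
      have := convexHull_nonempty_iff.1 ⟨q, hq⟩
      exact this.of_image
    obtain ⟨v, hv, hmax⟩ := Set.exists_max_image (vertices P) l hP.finite_vertices hne
    have hlv : ∀ x ∈ P, l.toLinearMap x ≤ l.toLinearMap v := hP.le_of_vertices _ _ hmax
    have hbound : ∀ {χ : E → E},
        (∀ v u, Adjacent P v u → ∃ k : ℝ, 0 ≤ k ∧ χ u - χ v = k • (u - v)) →
        ∀ x ∈ convexHull ℝ (χ '' vertices P), l x ≤ l (χ v) := by
      intro χ hχ x hx
      have hconv : Convex ℝ {y | l y ≤ l (χ v)} := convex_halfSpace_le l.isBoundedLinearMap.toIsLinearMap _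
      refine convexHull_min ?_ hconv hx
      rintro _ ⟨w, hw, rfl⟩
      exact hP.map_le_of_parallel hχ hv l.toLinearMap hlv hw
    have h1 := hbound hφ q hq
    have h2 := hbound hψ r hr
    have h3 := hl v hv.1
    have h4 := congrArg l (hsum v)
    rw [map_add] at h4
    have hu' : u < l (q + r) := hu
    rw [map_add] at hu'
    linarith

/-- The functional exposing `v` is maximal over the hull at `ψ v`, so the homothety must carry `ψ v`
to `v`. -/
theorem IsPolytope.sub_eq_of_homothetic {P : Set E} (hP : IsPolytope P) {ψ : E → E}
    (hψ : ∀ v u, Adjacent P v u → ∃ k : ℝ, 0 ≤ k ∧ ψ u - ψ v = k • (u - v))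
    (h : Homothetic (convexHull ℝ (ψ '' vertices P)) P) :
    ∃ r : ℝ, ∀ v ∈ vertices P, ∀ w ∈ vertices P, v - w = r • (ψ v - ψ w) := by
  obtain ⟨r, t, hr, hPr⟩ := h
  have key : ∀ v ∈ vertices P, r • ψ v + t = v := by
    intro v hv
    obtain ⟨f, c, hf, hfv⟩ := (hP.isFace_singleton hv).exists_functional
      (Set.singleton_nonempty v)
    have hvc : f v = c := by
      have : v ∈ ({v} : Set E) := rfl
      rw [hfv] at this; exact this.2
    have hmem : r • ψ v + t ∈ P := by
      rw [hPr]
      exact ⟨ψ v, subset_convexHull ℝ _ ⟨v, hv, rfl⟩, rfl⟩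
    have hv' := hv.1
    rw [hPr] at hv'
    obtain ⟨q, hq, hqv⟩ := hv'
    have hconv : Convex ℝ {y | f y ≤ f (ψ v)} := convex_halfSpace_le f.isLinear _
    have hq' : f q ≤ f (ψ v) := by
      refine convexHull_min ?_ hconv hq
      rintro _ ⟨w, hw, rfl⟩
      exact hP.map_le_of_parallel hψ hv f (fun x hx => hvc ▸ hf x hx) hw
    have h1 := congrArg f hqv
    simp only [map_add, map_smul, smul_eq_mul] at h1
    have h2 := mul_le_mul_of_nonneg_left hq' hr.le
    have h3 := hf _ hmem
    have h4 : f (r • ψ v + t) = c := by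
      refine le_antisymm h3 ?_
      rw [map_add, map_smul, smul_eq_mul]
      linarith
    have : r • ψ v + t ∈ ({v} : Set E) := by rw [hfv]; exact ⟨hmem, h4⟩
    exact this
  refine ⟨r, fun v hv w hw => ?_⟩
  conv_lhs => rw [← key v hv, ← key w hw]
  rw [smul_sub]
  abel

/-- A polytope is decomposable if its vertices can be moved in such a way that the direction of
each edge is preserved and the edges are not all scaled by the same factor. -/
theorem IsPolytope.isDecomposable_of_parallel {P : Set E} (hP : IsPolytope P) {δ : E → E}
    (hδ : ∀ v u, Adjacent P v u → ∃ k : ℝ, δ u - δ v = k • (u - v)) {a b a' b' : E} {k k' : ℝ}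
    (hab : Adjacent P a b) (hk : δ b - δ a = k • (b - a))
    (hab' : Adjacent P a' b') (hk' : δ b' - δ a' = k' • (b' - a')) (hne : k ≠ k') :
    IsDecomposable P := by
  choose! κ hκ using hδ
  obtain ⟨M, hM⟩ := ((hP.finite_vertices.prod hP.finite_vertices).image
    (fun p : E × E => |κ p.1 p.2|)).bddAbove
  have hM' : ∀ v u, Adjacent P v u → |κ v u| ≤ M := fun v u h =>
    hM ⟨(v, u), ⟨h.left_mem_vertices, h.right_mem_vertices⟩, rfl⟩
  have hM0 : 0 < M + 1 := by linarith [(abs_nonneg _).trans (hM' a b hab)]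
  -- The summands come from `(v ± t • δ v) / 2`; as `M` bounds the edge factors, `t = 1 / (M + 1)`
  -- keeps the new factors nonnegative.
  have hpar : ∀ t : ℝ, |t| ≤ 1 / (M + 1) → ∀ v u, Adjacent P v u → ∃ k : ℝ, 0 ≤ k ∧
      ((1 / 2 : ℝ) • (u + t • δ u)) - ((1 / 2 : ℝ) • (v + t • δ v)) = k • (u - v) := by
    intro t ht v u hvu
    refine ⟨1 / 2 * (1 + t * κ v u), ?_, ?_⟩
    · have h1 : |t * κ v u| ≤ 1 := by
        rw [abs_mul]
        calc |t| * |κ v u| ≤ 1 / (M + 1) * M :=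
              mul_le_mul ht (hM' v u hvu) (abs_nonneg _) (by positivity)
          _ ≤ 1 := by
              rw [div_mul_eq_mul_div, div_le_one hM0]
              linarith
      have := neg_le_of_abs_le h1
      linarith
    · have h1 := hκ v u hvu
      rw [mul_smul, add_smul, one_smul, mul_smul, ← h1]
      module
  have hnot : ∀ t : ℝ, t ≠ 0 → |t| ≤ 1 / (M + 1) →
      ¬ Homothetic (convexHull ℝ ((fun v => (1 / 2 : ℝ) • (v + t • δ v)) '' vertices P)) P := by
    intro t ht0 ht hom
    obtain ⟨r, hr⟩ := hP.sub_eq_of_homothetic (hpar t ht) hom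
    have key : ∀ {a b : E} {k : ℝ}, Adjacent P a b → δ b - δ a = k • (b - a) →
        r * (1 + t * k) = 2 := by
      intro a b k hab hk
      have h1 := hr b hab.right_mem_vertices a hab.left_mem_vertices
      have h2 : (1 - r * (1 / 2 * (1 + t * k))) • (b - a) = 0 := by
        have h3 : r • ((1 / 2 : ℝ) • (b + t • δ b) - (1 / 2 : ℝ) • (a + t • δ a)) =
            (r * (1 / 2)) • ((b - a) + t • (δ b - δ a)) := by module
        rw [h3, hk] at h1
        rw [sub_smul, one_smul, sub_eq_zero]
        nth_rewrite 1 [h1]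
        module
      rcases smul_eq_zero.1 h2 with h3 | h3
      · linarith
      · exact absurd (sub_eq_zero.1 h3).symm hab.1
    have e1 := key hab hk
    have e2 := key hab' hk'
    have hr0 : r ≠ 0 := by rintro rfl; simp at e1
    have e3 : r * t * (k - k') = 0 := by linear_combination e1 - e2
    exact mul_ne_zero (mul_ne_zero hr0 ht0) (sub_ne_zero.2 hne) e3
  have ht : |1 / (M + 1)| ≤ 1 / (M + 1) := (abs_of_pos (by positivity)).le
  have ht' : |-(1 / (M + 1))| ≤ 1 / (M + 1) := by rwa [abs_neg]
  have ht0 : 1 / (M + 1) ≠ 0 := by positivity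
  exact ⟨_, _, ⟨_, hP.finite_vertices.image _, rfl⟩, ⟨_, hP.finite_vertices.image _, rfl⟩,
    hP.eq_add_of_parallel (hpar _ ht) (hpar _ ht') (fun v => by module), hnot _ ht0 ht,
    hnot _ (neg_ne_zero.2 ht0) ht'⟩

/-- Two adjacent vertices of a facet with Shephard's property and their neighbours off the facet
lie in a plane. -/
theorem IsFacet.sub_mem_span_of_shephard {P F : Set E} (hP : IsPolytope P) (hF : IsFacet P F)
    {v u v' u' : E} (huF : u ∈ F) (hvF : v ∈ F) (h : Adjacent P v u)
    (hv' : nb P v \ F = {v'}) (hu' : nb P u \ F = {u'}) :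
    u' - v ∈ Submodule.span ℝ {u - v, v' - v} := by
  have hvV := h.left_mem_vertices
  obtain ⟨l, c, hl, hFl⟩ := hF.1.exists_functional hF.2.1
  obtain ⟨m, μ, hm, hme⟩ := h.isFace.exists_functional ⟨v, left_mem_segment ℝ v u⟩
  have hseg : segment ℝ v u ⊆ F := (IsExposed.convex hF.1 hP.convex).segment_subset hvF huF
  have hFc : ∀ x ∈ F, l x = c := fun x hx => by rw [hFl] at hx; exact hx.2
  have hnF : ∀ x ∈ P, x ∉ F → l x < c := fun x hx hxF =>
    lt_of_le_of_ne (hl x hx) fun h => hxF (by rw [hFl]; exact ⟨hx, h⟩)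
  have hv'm : v' ∈ nb P v \ F := by rw [hv']; rfl
  -- Tilting the functional exposing the edge away from `F` produces a face `G` with `G ∩ F` equal
  -- to the edge and `G` not inside `F`. It must contain `u'`, and in it `v` has no neighbours
  -- besides `u` and `v'`.
  obtain ⟨s, hs, hle, q, hq, hqm, hqe⟩ := hP.exists_rotation (m := -l) (μ := -c) hm
    (fun x hx hxm => by
      have : x ∈ F := hseg (by rw [hme]; exact ⟨hx, hxm⟩)
      rw [LinearMap.neg_apply, hFc x this])
    (nb_subset _ _ hv'm.1) (neg_lt_neg (hnF v' (nb_subset _ _ hv'm.1) hv'm.2))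
  set G := {x ∈ P | (m + s • -l) x = μ + s * -c} with hG
  have hGf : IsFace P G := isFace_of_le _ _ hle
  have hqF : q ∉ F := fun hqF => by
    rw [LinearMap.neg_apply, hFc q hqF] at hqm
    exact lt_irrefl _ hqm
  have hGF : ∀ x ∈ G, x ∈ F → x ∈ segment ℝ v u := by
    rintro x ⟨hx, hxe⟩ hxF
    simp only [LinearMap.add_apply, LinearMap.smul_apply, LinearMap.neg_apply, smul_eq_mul,
      hFc x hxF] at hxe
    rw [hme]
    exact ⟨hx, by linarith⟩
  have hsegG : segment ℝ v u ⊆ G := by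
    intro x hx
    have hxF := hseg hx
    rw [hme] at hx
    refine ⟨hx.1, ?_⟩
    simp [hx.2, hFc x hxF]
  have hvG := hsegG (left_mem_segment ℝ v u)
  have huG := hsegG (right_mem_segment ℝ v u)
  have hnot : ¬ G ⊆ F := fun hsub => hqF (hsub ⟨hq, hqe⟩)
  have hout : ∀ {a a' : E}, a ∈ vertices P → a ∈ G → a ∈ F → nb P a \ F = {a'} → a' ∈ G := by
    intro a a' ha haG haF haa
    obtain ⟨x, hx, hxF⟩ := hGf.exists_nb_notMem hP hF.1 ha haG haF hnot
    have hxG := nb_subset _ _ hx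
    rw [hGf.nb_eq hP haG] at hx
    have : x ∈ nb P a \ F := ⟨hx.1, hxF⟩
    rw [haa, Set.mem_singleton_iff] at this
    exact this ▸ hxG
  have hu'G := hout h.right_mem_vertices huG huF hu'
  have h1 := (hGf.isPolytope hP).sub_mem_span_nb (hGf.mem_vertices_of_mem hvV hvG) hu'G
  refine Submodule.span_mono ?_ h1
  rintro _ ⟨x, hx, rfl⟩
  have hxG := nb_subset _ _ hx
  rw [hGf.nb_eq hP hvG] at hx
  by_cases hxF : x ∈ F
  · left
    rw [h.eq_of_mem_segment hx.1 (hGF x hxG hxF)]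
  · right
    have : x ∈ nb P v \ F := ⟨hx.1, hxF⟩
    rw [hv', Set.mem_singleton_iff] at this
    rw [this]
    rfl

/-- If at least two vertices lie off a proper face, two adjacent vertices do. -/
theorem IsPolytope.exists_adjacent_off_face {P F : Set E} (hP : IsPolytope P) (hF : IsFace P F)
    (hne : F.Nonempty) {a b : E} (ha : a ∈ vertices P) (hb : b ∈ vertices P) (hab : a ≠ b)
    (haF : a ∉ F) (hbF : b ∉ F) : ∃ x y, Adjacent P x y ∧ x ∉ F ∧ y ∉ F := by
  obtain ⟨l, c, hl, hFl⟩ := hF.exists_functional hne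
  have hFc : ∀ x ∈ F, l x = c := fun x hx => by rw [hFl] at hx; exact hx.2
  have hnF : ∀ x ∈ P, x ∉ F → l x < c := fun x hx hxF =>
    lt_of_le_of_ne (hl x hx) fun h => hxF (by rw [hFl]; exact ⟨hx, h⟩)
  -- An edge descending in `l` from a vertex off `F` stays off `F`, where `l` is maximal. If neither
  -- `a` nor `b` has one, both minimize `l`, and the face of minimizers has an edge at `a`.
  have hdesc : ∀ x ∈ vertices P, x ∉ F → (∃ y ∈ P, l y < l x) →
      ∃ x y, Adjacent P x y ∧ x ∉ F ∧ y ∉ F := by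
    rintro x hx hxF ⟨y, hy, hyx⟩
    obtain ⟨u, hu, hux⟩ : ∃ u ∈ nb P x, l u < l x := by
      by_contra hcon
      push Not at hcon
      have := hP.le_of_nb hx (-l) (fun u hu => neg_le_neg (hcon u hu)) y hy
      simp only [LinearMap.neg_apply] at this
      linarith
    refine ⟨x, u, hu, hxF, fun huF => ?_⟩
    have h1 := hnF x hx.1 hxF
    rw [hFc u huF] at hux
    linarith
  by_cases h1 : ∃ y ∈ P, l y < l a
  · exact hdesc a ha haF h1
  by_cases h2 : ∃ y ∈ P, l y < l b
  · exact hdesc b hb hbF h2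
  push Not at h1 h2
  have hle : ∀ x ∈ P, (-l) x ≤ -(l a) := fun x hx => neg_le_neg (h1 x hx)
  have hM := isFace_of_le _ _ hle
  have haM : a ∈ {x ∈ P | (-l) x = -(l a)} := ⟨ha.1, rfl⟩
  have hbM : b ∈ {x ∈ P | (-l) x = -(l a)} :=
    ⟨hb.1, congrArg Neg.neg (le_antisymm (h2 a ha.1) (h1 b hb.1))⟩
  have hdim : dim {x ∈ P | (-l) x = -(l a)} ≠ 0 := by
    intro h0
    have := ((hP.isFace_singleton ha).mono hM (by simpa using haM)).eq_of_dim_le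
      (Set.singleton_nonempty a) (by rw [h0]; exact Nat.zero_le _)
    rw [← this] at hbM
    exact hab hbM.symm
  obtain ⟨u, hu⟩ := (hM.isPolytope hP).exists_edge hdim (hM.mem_vertices_of_mem ha haM)
  rw [hM.nb_eq hP haM] at hu
  refine ⟨a, u, hu.1, haF, fun huF => ?_⟩
  have h3 : -(l u) = -(l a) := hu.2.2
  have h4 := hnF a ha.1 haF
  have h5 := hFc u huF
  linarith

theorem IsFacet.isPyramid {P F : Set E} (hP : IsPolytope P) (hF : IsFacet P F) {a : E}
    (ha : a ∈ vertices P) (haF : a ∉ F) (h : ∀ v ∈ vertices P, v ∉ F → v = a) : IsPyramid P := by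
  refine ⟨F, a, hF.isPolytope hP, fun haff => ?_, ?_⟩
  · obtain ⟨y, hy⟩ := hF.2.1
    refine haF (hF.1.mem_of_sub_mem hy ha.1 ?_)
    rw [← direction_affineSpan]
    exact AffineSubspace.vsub_mem_direction haff (subset_affineSpan ℝ _ hy)
  · apply Set.Subset.antisymm
    · conv_lhs => rw [hP.eq_convexHull_vertices]
      refine convexHull_mono fun v hv => ?_
      by_cases hvF : v ∈ F
      · exact Or.inr hvF
      · exact Or.inl (h v hv hvF)
    · refine convexHull_min ?_ hP.convex
      exact Set.insert_subset ha.1 hF.1.subset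

/-- A Shephard polytope is decomposable or a pyramid. -/
theorem IsFacet.isDecomposable_or_isPyramid {P F : Set E} (hP : IsPolytope P) (hF : IsFacet P F)
    (hS : ∀ v ∈ vertices P, v ∈ F → (nb P v \ F).ncard = 1) :
    IsDecomposable P ∨ IsPyramid P := by
  classical
  obtain ⟨z, hzF'⟩ := (hF.isPolytope hP).vertices_nonempty hF.2.1
  have hz : z ∈ vertices P := by rw [hF.1.vertices_eq] at hzF'; exact hzF'.2
  have hzF := hzF'.1
  have hex : ∀ v, v ∈ vertices P → v ∈ F → ∃ u, nb P v \ F = {u} := fun v hv hvF =>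
    Set.ncard_eq_one.1 (hS v hv hvF)
  choose! o ho using hex
  have hom : ∀ v ∈ vertices P, v ∈ F → o v ∈ nb P v \ F := fun v hv hvF => by
    rw [ho v hv hvF]; rfl
  have hoz := hom z hz hzF
  by_cases hone : ∀ v ∈ vertices P, v ∉ F → v = o z
  · exact Or.inr (hF.isPyramid hP (nb_subset_vertices _ _ hoz.1) hoz.2 hone)
  left
  push Not at hone
  obtain ⟨b, hb, hbF, hbo⟩ := hone
  obtain ⟨x, y, hxy, hxF, hyF⟩ := hP.exists_adjacent_off_face hF.1 hF.2.1 hb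
    (nb_subset_vertices _ _ hoz.1) hbo hbF hoz.2
  obtain ⟨l, c, hl, hFl⟩ := hF.1.exists_functional hF.2.1
  have hFc : ∀ x ∈ F, l x = c := fun x hx => by rw [hFl] at hx; exact hx.2
  have hnF : ∀ x ∈ P, x ∉ F → c - l x ≠ 0 := fun x hx hxF h =>
    hxF (by rw [hFl]; exact ⟨hx, (sub_eq_zero.1 h).symm⟩)
  -- The factor normalizes the motion along the outgoing edge so that `l` drops by one at every
  -- vertex of `F`; vertices off `F` stay fixed.
  set δ : E → E := fun v => if v ∈ F then (c - l (o v))⁻¹ • (o v - v) else 0 with hδ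
  have hδF : ∀ v ∈ F, δ v = (c - l (o v))⁻¹ • (o v - v) := fun v hv => if_pos hv
  have hδn : ∀ v, v ∉ F → δ v = 0 := fun v hv => if_neg hv
  have hcross : ∀ v u, Adjacent P v u → v ∈ F → u ∉ F →
      δ u - δ v = (-(c - l (o v))⁻¹) • (u - v) := by
    intro v u h hvF huF
    have hu : u ∈ nb P v \ F := ⟨h, huF⟩
    rw [ho v h.left_mem_vertices hvF, Set.mem_singleton_iff] at hu
    rw [hδn u huF, hδF v hvF, hu, zero_sub, neg_smul]
  have hpar : ∀ v u, Adjacent P v u → ∃ k : ℝ, δ u - δ v = k • (u - v) := by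
    intro v u h
    by_cases hvF : v ∈ F <;> by_cases huF : u ∈ F
    · have hv := h.left_mem_vertices
      have hu := h.right_mem_vertices
      have h1 := hF.sub_mem_span_of_shephard hP huF hvF h (ho v hv hvF) (ho u hu huF)
      obtain ⟨α, β, hαβ⟩ := Submodule.mem_span_pair.1 h1
      have h2 := congrArg l hαβ
      simp only [map_add, map_smul, map_sub, smul_eq_mul, hFc v hvF, hFc u huF] at h2
      have hv0 := hnF _ (nb_subset _ _ (hom v hv hvF).1) (hom v hv hvF).2
      have hu0 := hnF _ (nb_subset _ _ (hom u hu huF).1) (hom u hu huF).2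
      -- Applying `l` to the planar relation compares the depths of the two outer neighbours; the
      -- normalization cancels the components transverse to the edge.
      have hβ : (c - l (o u))⁻¹ * β = (c - l (o v))⁻¹ := by
        field_simp
        linarith
      refine ⟨(c - l (o u))⁻¹ * (α - 1), ?_⟩
      rw [hδF u huF, hδF v hvF, ← hβ]
      have h3 : o u - u = (α - 1) • (u - v) + β • (o v - v) := by
        rw [sub_smul, one_smul, ← sub_add_sub_cancel (o u) v u, ← hαβ]
        abel
      rw [h3]
      module
    · exact ⟨_, hcross v u h hvF huF⟩
    · refine ⟨-(c - l (o u))⁻¹, ?_⟩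
      rw [← neg_sub, hcross u v h.symm huF hvF, ← smul_neg, neg_sub]
    · exact ⟨0, by rw [hδn v hvF, hδn u huF]; simp⟩
  -- The edge `x y` off `F` has factor zero, while the edge leaving `F` at `z` has a nonzero factor.
  refine hP.isDecomposable_of_parallel hpar hxy (k := 0) ?_ hoz.1 (hcross z _ hoz.1 hzF hoz.2) ?_
  · rw [hδn x hxF, hδn y hyF]; simp
  · exact (neg_ne_zero.2 (inv_ne_zero (hnF _ (nb_subset _ _ hoz.1) hoz.2))).symm

/-! ### Existence of a facet with Shephard's property -/

theorem hasShephardProperty_iff {P F : Set E} : HasShephardProperty P F ↔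
    ∀ v ∈ vertices P, v ∈ F → (nb P v \ F).ncard = 1 := by
  refine forall₃_congr fun v _ _ => ?_
  rw [Set.ncard_eq_one]
  constructor
  · rintro ⟨u, hu, huniq⟩
    exact ⟨u, Set.eq_singleton_iff_unique_mem.2 ⟨hu, huniq⟩⟩
  · rintro ⟨u, hu⟩
    obtain ⟨h1, h2⟩ := Set.eq_singleton_iff_unique_mem.1 hu
    exact ⟨u, h1, h2⟩

/-- A polytope with at most one nonsimple vertex has a facet with Shephard's property. -/
theorem IsPolytope.exists_shephard_of_subset_singleton {P : Set E} (hP : IsPolytope P)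
    (hd : dim P ≠ 0) {w : E} (h : ∀ v ∈ vertices P, v ≠ w → degree P v = dim P) :
    ∃ F, IsFacet P F ∧ HasShephardProperty P F := by
  -- `x` is the point that the facet will avoid; it is `w` whenever `w ∈ P`.
  have hw : ∃ u ∈ vertices P, ∃ x ∈ P, u ≠ x ∧ (w ∈ P → x = w) := by
    obtain ⟨a, ha, b, hb, hab⟩ := hP.exists_vertices_ne hd
    by_cases hwP : w ∈ P
    · by_cases haw : a = w
      · exact ⟨b, hb, w, hwP, haw ▸ hab.symm, fun _ => rfl⟩
      · exact ⟨a, ha, w, hwP, haw, fun _ => rfl⟩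
    · exact ⟨a, ha, b, hb.1, hab, fun h => absurd h hwP⟩
  obtain ⟨u, hu, x, hx, hux, hxw⟩ := hw
  obtain ⟨F, hF, -, hxF⟩ := hP.exists_isFacet_notMem (hP.isFace_singleton hu)
    (Set.singleton_nonempty u) hx hux.symm
  refine ⟨F, hF, hasShephardProperty_iff.2 fun v hv hvF => ?_⟩
  refine hF.out_eq_one hP hv hvF (h v hv ?_)
  rintro rfl
  exact hxF (hxw hv.1 ▸ hvF)

/-- A `d`-polytope of excess `d - 2` has a facet with Shephard's property. -/
theorem IsPolytope.isShephard_of_excess {P : Set E} (hP : IsPolytope P) (hd : 3 ≤ dim P)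
    (hex : excess P = (dim P : ℤ) - 2) : IsShephard P := by
  by_cases hd4 : 4 ≤ dim P
  · obtain ⟨F, hF, hFs⟩ := hP.exists_not_isSimple_facet hd4 hex
    have hexF := hF.excess_eq_of_not_isSimple hP hFs hex
    obtain ⟨w, hw, hw1, hw0⟩ := hF.exists_excessDefect hP (by omega)
    by_cases hwF : w ∈ F
    · refine hP.exists_shephard_of_subset_singleton (by omega) (w := w) fun v hv hvw => ?_
      refine hF.degree_eq_dim_of_excessDefect hP hv (hw0 v hv hvw) fun u hu huF =>
        hw0 u (nb_subset_vertices _ _ hu) ?_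
      rintro rfl
      exact huF hwF
    · refine ⟨F, hF, hasShephardProperty_iff.2 fun v hv hvF => ?_⟩
      have := hw0 v hv (by rintro rfl; exact hwF hvF)
      rw [excessDefect, if_pos hvF] at this
      omega
  · obtain ⟨G, H, hG, hH, -, hGs, hHs, hne, hdim⟩ := hP.exists_simple_facets hd hex
    obtain ⟨hj, hns, hcard, -⟩ := (hG.le_excess_of_inter hP hH hGs hHs hne hdim).2 hex
    have h0 : dim (G ∩ H) = 0 := by omega
    rw [h0, zero_add, ← hns] at hcard
    obtain ⟨w, hw⟩ := Set.ncard_eq_one.1 hcard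
    refine hP.exists_shephard_of_subset_singleton (by omega) (w := w) fun v hv hvw => ?_
    by_contra hvd
    have : v ∈ nonsimpleVertices P := ⟨hv, hvd⟩
    rw [hw] at this
    exact hvw this

end FiniteDimensional

/-! ### The third facet and the main theorem -/

section FiniteDimensional

variable [FiniteDimensional ℝ E]

/-- Besides any two facets, a `d`-polytope of excess `d - 2` has a facet of excess `d - 3`. -/
theorem IsPolytope.exists_third_facet {P G H : Set E} (hP : IsPolytope P) (hd : 3 ≤ dim P)
    (hex : excess P = (dim P : ℤ) - 2) (hGs : IsSimple G) (hHs : IsSimple H) :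
    ∃ F, IsFacet P F ∧ F ≠ G ∧ F ≠ H ∧ excess F = (dim P : ℤ) - 3 := by
  by_cases hd4 : 4 ≤ dim P
  · obtain ⟨F, hF, hFs⟩ := hP.exists_not_isSimple_facet hd4 hex
    exact ⟨F, hF, fun h => hFs (h ▸ hGs), fun h => hFs (h ▸ hHs),
      hF.excess_eq_of_not_isSimple hP hFs hex⟩
  · obtain ⟨v, hv, -⟩ := hP.exists_vertices_ne (by omega)
    have h1 := hP.le_ncard_facetsThrough (hP.isFace_singleton hv) (Set.singleton_nonempty v)
    rw [dim_singleton] at h1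
    have h2 : ¬ facetsThrough P {v} ⊆ {G, H} := fun hsub => by
      have := (Set.ncard_le_ncard hsub).trans (Set.ncard_insert_le G {H})
      rw [Set.ncard_singleton] at this
      omega
    obtain ⟨F, hF, hne⟩ := Set.not_subset.1 h2
    simp only [Set.mem_insert_iff, Set.mem_singleton_iff, not_or] at hne
    have hFp := hF.1.isPolytope hP
    have hdF := hF.1.2.2
    have := (hFp.isSimple_of_dim_le_two (by omega)).excess_eq_zero hFp
    exact ⟨F, hF.1, hne.1, hne.2, by omega⟩

end FiniteDimensional

end ConvexPolytope

theorem mainTheorem2 {E : Type*} [NormedAddCommGroup E] [InnerProductSpace ℝ E]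
    [FiniteDimensional ℝ E] (d : ℕ) (hd : 3 ≤ d) (P : Set E)
    (hP : ConvexPolytope.IsPolytope P) (hdim : ConvexPolytope.dim P = d)
    (hexc : ConvexPolytope.excess P = (d : ℤ) - 2) :
    (∃ F₁ F₂ : Set E,
      ConvexPolytope.IsFacet P F₁ ∧ ConvexPolytope.IsFacet P F₂ ∧ F₁ ≠ F₂ ∧
      ((∃ v : E, ConvexPolytope.nonsimpleVertices P = {v} ∧ F₁ ∩ F₂ = {v}) ∨
        ((ConvexPolytope.nonsimpleVertices P).ncard = d - 2 ∧
          (∀ v ∈ ConvexPolytope.nonsimpleVertices P, ConvexPolytope.vertexExcess P v = 1) ∧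
          ConvexPolytope.IsSimplexOn (F₁ ∩ F₂) (ConvexPolytope.nonsimpleVertices P) (d - 3))) ∧
      ConvexPolytope.IsSimple F₁ ∧ ConvexPolytope.IsSimple F₂ ∧
      ∃ F₃ : Set E, ConvexPolytope.IsFacet P F₃ ∧ F₃ ≠ F₁ ∧ F₃ ≠ F₂ ∧
        ConvexPolytope.excess F₃ = (d : ℤ) - 3) ∧
    ConvexPolytope.IsShephard P ∧
    (ConvexPolytope.IsDecomposable P ∨ ConvexPolytope.IsPyramid P) := by

  subst hdim
  obtain ⟨G, H, hG, hH, hGH, hGs, hHs, hne, hdim⟩ := hP.exists_simple_facets hd hexc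
  obtain ⟨hj, hns, hcard, hvex⟩ := (hG.le_excess_of_inter hP hH hGs hHs hne hdim).2 hexc
  have hIp := (hG.1.inter hH.1).isPolytope hP
  have hShep := hP.isShephard_of_excess hd hexc
  refine ⟨⟨G, H, hG, hH, hGH, ?_, hGs, hHs, hP.exists_third_facet hd hexc hGs hHs⟩, hShep, ?_⟩
  · rcases hj with h0 | h3
    · left
      rw [h0, zero_add] at hcard
      obtain ⟨v, hv⟩ := Set.ncard_eq_one.1 hcard
      refine ⟨v, hns.trans hv, ?_⟩
      rw [hIp.eq_convexHull_vertices, hv, convexHull_singleton]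
    · right
      rw [hns]
      refine ⟨by omega, fun v hv => ?_, hIp.finite_vertices, by omega, ?_,
        hIp.eq_convexHull_vertices⟩
      · have := hvex v hv
        omega
      · exact hIp.affineIndependent_vertices rfl hcard
  · obtain ⟨F, hF, hFS⟩ := hShep
    exact hF.isDecomposable_or_isPyramid hP (ConvexPolytope.hasShephardProperty_iff.1 hFS)
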